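/- Write $e(x)=e^{2\pi i x}$. For $n\ge 1$ let $\mathbb H_n$ be the Siegel upper half space of complex symmetric $n\times n$ matrices with positive definite imaginary part. Let $g\ge 2$ and $k\in\tfrac12\mathbb Z$. A *Jacobi form* of genus $g-1$, weight $k$ and index $m\in\mathbb Z_{\ge 0}$ (of trivial type) is a holomorphic function $\phi:\mathbb H_{g-1}\times\mathbb C^{g-1}\to\mathbb C$ such that 1. for all $\gamma=\begin{pmatrix}a&b\\c&d\end{pmatrix}\in \mathrm{Sp}_{2(g-1)}(\mathbb Z)$ and every holomorphic square root $\omega$ of $\det(c\tau_1+d)$ on $\mathbb H_{g-1}$, $$\phi\big((a\tau_1+b)(c\tau_1+d)^{-1},\,{}^{t}(c\tau_1+d)^{-1}z\big)=\omega(\tau_1)^{2k}\,e\big(m\,{}^{t}z(c\tau_1+d)^{-1}c\,z\big)\,\phi(\tau_1,z);$$ 2. $\phi(\tau_1,z+\tau_1 l+\mu)=e\big(-m({}^{t}l\tau_1l+2\,{}^{t}l z)\big)\phi(\tau_1,z)$ for all $l,\mu\in\mathbb Z^{g-1}$; 3. $\phi$ has an absolutely convergent Fourier expansion $\phi(\tau_1,z)=\sum_{s,r}c(\phi;s,r)\,e(\mathrm{tr}(s\tau_1)+{}^{t}rz)$,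 where $s$ runs through half-integral symmetric matrices and $r$ through $\mathbb Z^{g-1}$; if $g-1=1$, then in addition $c(\phi;s,r)\neq0$ only if $\begin{pmatrix}s&r/2\\{}^{t}r/2&m\end{pmatrix}$ is positive semidefinite. A *symmetric formal Fourier–Jacobi series* of genus $g$, cogenus $1$ and weight $k$ is a formal series $f=\sum_{m\ge0}\phi_m(\tau_1,z)\,q_2^m$, where $\phi_m$ is a Jacobi form of genus $g-1$, weight $k$ and index $m$, whose coefficients $c(f;t)=c(\phi_m;s,r)$ for $t=\begin{pmatrix}s&r/2\\{}^{t}r/2&m\end{pmatrix}$ (with $c(f;t)=0$ if $m<0$) satisfy $c(f;t)=w^{2k}\,c(f;{}^{t}u\,t\,u)$ for all half-integral symmetric $g\times g$ matrices $t$, all $u\in\mathrm{GL}_g(\mathbb Z)$ and all $w\in\mathbb C$ with $w^2=\det u$ (so $w^{2k}=\det(u)^k$ for integral $k$). It is *cuspidal* if $\phi_0=0$. For $N\in\mathbb Z_{>0}$, a point $(\tau_1,z)\in\mathbb H_{g-1}\times\mathbb C^{g-1}$ is an *$N$-torsion point* if $z=\tau_1\lambda+\mu$ with $\lambda,\mu\in\frac1N\mathbb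 Z^{g-1}$; it is a *torsion point* if it is an $N$-torsion point for some $N\in\mathbb Z_{>0}$. **Corollary.** Let $f=\sum_m\phi_m q_2^m$ be a cuspidal symmetric formal Fourier–Jacobi series of genus $g\ge2$, cogenus $1$ and weight $k$. Let $(\tau_1,z)\in\mathbb H_{g-1}\times\mathbb C^{g-1}$ be an $N$-torsion point, and put $C={}^{t}(\operatorname{Im}z)(\operatorname{Im}\tau_1)^{-1}(\operatorname{Im}z)$. Then the power series $\sum_m\phi_m(\tau_1,z)\,q_2^m$ converges absolutely on the disc $|q_2|<e^{-2\pi C}$ and defines a holomorphic function of $q_2$ there. In particular, for every $\tau=\begin{pmatrix}\tau_1&z\\{}^{t}z&\tau_2\end{pmatrix}\in\mathbb H_g$ for which $(\tau_1,z)$ is a torsion point, the series $\sum_m\phi_m(\tau_1,z)\,e(\tau_2)^m$ converges absolutely. -/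

import Mathlib

namespace FJ

open Matrix

/-- `e(x) = exp(2 π i x)`. -/
noncomputable def e (x : ℂ) : ℂ := Complex.exp (2 * Real.pi * Complex.I * x)

/-- Entrywise imaginary part of a complex matrix. -/
def imMat {ι : Type*} (τ : Matrix ι ι ℂ) : Matrix ι ι ℝ := τ.map Complex.im

/-- The Siegel upper half space: complex symmetric matrices with positive definite
imaginary part, with rows and columns indexed by `ι` (the genus is the cardinality of `ι`). -/
def siegelUpperHalf (ι : Type*) [Fintype ι] : Set (Matrix ι ι ℂ) :=
  {τ | τ.IsSymm ∧ (imMat τ).PosDef}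

/-- Half-integral symmetric matrices: integral diagonal, off-diagonal entries in `½ ℤ`. -/
def IsHalfIntegral {ι : Type*} (t : Matrix ι ι ℚ) : Prop :=
  t.IsSymm ∧ (∀ i, ∃ a : ℤ, t i i = a) ∧ ∀ i j, ∃ a : ℤ, 2 * t i j = a

/-- The matrix `t = (s, r/2; rᵀ/2, m)` of size `n + 1`. -/
def blockIndex {n : ℕ} (s : Matrix (Fin n) (Fin n) ℚ) (r : Fin n → ℤ) (m : ℚ) :
    Matrix (Fin n ⊕ Unit) (Fin n ⊕ Unit) ℚ :=
  fromBlocks s (of fun i _ => (r i : ℚ) / 2) (of fun _ j => (r j : ℚ) / 2) (of fun _ _ => m)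

/-- `φ(τ, z) = ∑ c(s, r) e(tr(s τ) + rᵀ z)`, absolutely convergent on `ℍ_n × ℂⁿ`, where `s` runs
over half-integral matrices and `r` over integral vectors. The coefficients are uniquely
determined by `φ`. -/
def HasFourierExpansion {n : ℕ} (φ : Matrix (Fin n) (Fin n) ℂ → (Fin n → ℂ) → ℂ)
    (c : Matrix (Fin n) (Fin n) ℚ → (Fin n → ℤ) → ℂ) : Prop :=
  ∀ τ ∈ siegelUpperHalf (Fin n), ∀ z : Fin n → ℂ,
    HasSum
      (fun p : {s : Matrix (Fin n) (Fin n) ℚ // IsHalfIntegral s} × (Fin n → ℤ) =>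
        c p.1.1 p.2 *
          e ((p.1.1.map (fun x : ℚ => (x : ℂ)) * τ).trace + (fun i => (p.2 i : ℂ)) ⬝ᵥ z))
      (φ τ z)

/-- `a τ + b` for `γ = (a, b; c, d)`. -/
def num {n : ℕ} (γ : Matrix (Fin n ⊕ Fin n) (Fin n ⊕ Fin n) ℤ) (τ : Matrix (Fin n) (Fin n) ℂ) :
    Matrix (Fin n) (Fin n) ℂ :=
  γ.toBlocks₁₁.map (fun x : ℤ => (x : ℂ)) * τ + γ.toBlocks₁₂.map (fun x : ℤ => (x : ℂ))

/-- `c τ + d` for `γ = (a, b; c, d)`. -/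
def denom {n : ℕ} (γ : Matrix (Fin n ⊕ Fin n) (Fin n ⊕ Fin n) ℤ) (τ : Matrix (Fin n) (Fin n) ℂ) :
    Matrix (Fin n) (Fin n) ℂ :=
  γ.toBlocks₂₁.map (fun x : ℤ => (x : ℂ)) * τ + γ.toBlocks₂₂.map (fun x : ℤ => (x : ℂ))

/-- Jacobi forms of genus `n`, weight `k = κ / 2 ∈ ½ ℤ`, index `m` and trivial type.

An element of the metaplectic group over `γ = (a, b; c, d)` is a pair `(γ, ω)` with `ω`
a holomorphic square root of `det (c τ + d)` on `ℍ_n`, and its factor of automorphy of weight `k`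
is `ω(τ)^(2k)`. For each `γ` and `τ` the values `ω(τ)` are exactly the two square roots `w` of
`det (c τ + d)`, so invariance under the metaplectic group is invariance for all such `w`.
For even `κ` the factor `w ^ κ` is `det (c τ + d) ^ k`. -/
structure IsJacobiForm (n : ℕ) (κ : ℤ) (m : ℕ)
    (φ : Matrix (Fin n) (Fin n) ℂ → (Fin n → ℂ) → ℂ) : Prop where
  /-- Holomorphic on `ℍ_n × ℂⁿ` (an open subset of `Sym_n(ℂ) × ℂⁿ`). -/
  holomorphic : DifferentiableOn ℂ
    (fun p : Matrix (Fin n) (Fin n) ℂ × (Fin n → ℂ) => φ p.1 p.2)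
    (siegelUpperHalf (Fin n) ×ˢ Set.univ)
  /-- `φ((aτ+b)(cτ+d)⁻¹, (cτ+d)⁻ᵀ z) = det(cτ+d)^k e(m zᵀ(cτ+d)⁻¹c z) φ(τ, z)`. -/
  symplectic : ∀ γ ∈ symplecticGroup (Fin n) ℤ, ∀ τ ∈ siegelUpperHalf (Fin n),
    ∀ (z : Fin n → ℂ) (w : ℂ), w ^ 2 = (denom γ τ).det →
      φ (num γ τ * (denom γ τ)⁻¹) ((denom γ τ)⁻¹ᵀ *ᵥ z) =
        w ^ κ *
          e (m * (z ⬝ᵥ (((denom γ τ)⁻¹ * γ.toBlocks₂₁.map (fun x : ℤ => (x : ℂ))) *ᵥ z))) *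
          φ τ z
  /-- `φ(τ, z + τ l + μ) = e(-m (lᵀ τ l + 2 lᵀ z)) φ(τ, z)` for integral `l`, `μ`. -/
  heisenberg : ∀ (l μ : Fin n → ℤ), ∀ τ ∈ siegelUpperHalf (Fin n), ∀ z : Fin n → ℂ,
      φ τ (z + τ *ᵥ (fun i => (l i : ℂ)) + fun i => (μ i : ℂ)) =
        e (-(m * ((fun i => (l i : ℂ)) ⬝ᵥ (τ *ᵥ fun i => (l i : ℂ)) +
          2 * ((fun i => (l i : ℂ)) ⬝ᵥ z)))) * φ τ z
  /-- Fourier expansion; in genus `1`, holomorphy at the cusp is imposed: only coefficients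
  with `(s, r/2; rᵀ/2, m)` positive semidefinite may be nonzero. -/
  fourier : ∃ c : Matrix (Fin n) (Fin n) ℚ → (Fin n → ℤ) → ℂ, HasFourierExpansion φ c ∧
    (n = 1 → ∀ s r, IsHalfIntegral s → c s r ≠ 0 → (blockIndex s r m).PosSemidef)

/-- `a` is the family of Fourier coefficients `a(t) = c(f; t)` of the formal series
`f = ∑_{m ≥ 0} φ_m q₂^m`: `c(f; (s, r/2; rᵀ/2, m))` is the `(s, r)`-th Fourier coefficient of `φ_m`,
and `c(f; t) = 0` if the lower right entry of `t` is negative. -/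
def IsCoeffFamily {n : ℕ} (φ : ℕ → Matrix (Fin n) (Fin n) ℂ → (Fin n → ℂ) → ℂ)
    (a : Matrix (Fin n ⊕ Unit) (Fin n ⊕ Unit) ℚ → ℂ) : Prop :=
  (∀ m : ℕ, HasFourierExpansion (φ m) (fun s r => a (blockIndex s r m))) ∧
    ∀ t, IsHalfIntegral t → t (Sum.inr ()) (Sum.inr ()) < 0 → a t = 0

/-- `f = ∑_{m ≥ 0} φ_m q₂^m` is a symmetric formal Fourier-Jacobi series of genus `g = n + 1`,
cogenus `1`, weight `k = κ / 2` and trivial type: each `φ_m` is a Jacobi form of weight `k` and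
index `m`, and `c(f; t) = det(u)^k c(f; uᵀ t u)` for all `u ∈ GL_g(ℤ)`. As above,
`det(u)^k` stands for `w^(2k)`, with `w` any square root of `det u`. -/
structure IsSymmetricFJ (n : ℕ) (κ : ℤ)
    (φ : ℕ → Matrix (Fin n) (Fin n) ℂ → (Fin n → ℂ) → ℂ) : Prop where
  jacobi : ∀ m, IsJacobiForm n κ m (φ m)
  symmetric : ∃ a : Matrix (Fin n ⊕ Unit) (Fin n ⊕ Unit) ℚ → ℂ, IsCoeffFamily φ a ∧
    ∀ (u : GL (Fin n ⊕ Unit) ℤ) (w : ℂ),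
      w ^ 2 = ((u : Matrix (Fin n ⊕ Unit) (Fin n ⊕ Unit) ℤ).det : ℂ) →
      ∀ t, IsHalfIntegral t →
        a t = w ^ κ *
          a ((u.1.map (fun x : ℤ => (x : ℚ)))ᵀ * t * u.1.map (fun x : ℤ => (x : ℚ)))

/-- `f` is cuspidal if `φ_0 = 0` on `ℍ_n × ℂⁿ`. -/
def IsCuspidal {n : ℕ} (φ : ℕ → Matrix (Fin n) (Fin n) ℂ → (Fin n → ℂ) → ℂ) : Prop :=
  ∀ τ ∈ siegelUpperHalf (Fin n), ∀ z : Fin n → ℂ, φ 0 τ z = 0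

/-- `(τ, z) ∈ ℍ_n × ℂⁿ` is an `N`-torsion point: `z = τ l + μ` with `l, μ ∈ (1/N) ℤⁿ`. -/
def IsTorsionPoint {n : ℕ} (N : ℕ) (τ : Matrix (Fin n) (Fin n) ℂ) (z : Fin n → ℂ) : Prop :=
  τ ∈ siegelUpperHalf (Fin n) ∧ ∃ l μ : Fin n → ℤ,
    z = τ *ᵥ (fun i => (l i : ℂ) / N) + fun i => (μ i : ℂ) / N

/-- `C = (Im z)ᵀ (Im τ)⁻¹ (Im z)`. -/
noncomputable def torsionC {n : ℕ} (τ : Matrix (Fin n) (Fin n) ℂ) (z : Fin n → ℂ) : ℝ :=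
  (fun i => (z i).im) ⬝ᵥ ((imMat τ)⁻¹ *ᵥ fun i => (z i).im)

end FJ

namespace FJ

open Matrix

section PosSemidef

variable {ι : Type*} [Fintype ι]

open scoped MatrixOrder in
lemma exists_eq_transpose_mul_self {A : Matrix ι ι ℝ} (hA : A.PosSemidef) :
    ∃ B : Matrix ι ι ℝ, A = Bᵀ * B := by
  classical
  obtain ⟨B, hB⟩ := CStarAlgebra.nonneg_iff_eq_star_mul_self.mp hA.nonneg
  exact ⟨B, by simpa [star_eq_conjTranspose] using hB⟩

/-- The trace of a product of two positive semidefinite matrices is nonnegative. -/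
lemma trace_mul_nonneg {A B : Matrix ι ι ℝ} (hA : A.PosSemidef) (hB : B.PosSemidef) :
    0 ≤ (A * B).trace := by
  obtain ⟨C, rfl⟩ := exists_eq_transpose_mul_self hB
  rw [← Matrix.mul_assoc, trace_mul_comm, ← Matrix.mul_assoc]
  have := hA.mul_mul_conjTranspose_same C
  rw [conjTranspose_eq_transpose_of_trivial] at this
  exact this.trace_nonneg

lemma quadForm_le_trace_mul {A : Matrix ι ι ℝ} (hA : A.PosSemidef) (x : ι → ℝ) :
    x ⬝ᵥ (A *ᵥ x) ≤ A.trace * (x ⬝ᵥ x) := by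
  obtain ⟨B, rfl⟩ := exists_eq_transpose_mul_self hA
  have h1 : x ⬝ᵥ ((Bᵀ * B) *ᵥ x) = ∑ i, (∑ j, B i j * x j) ^ 2 := by
    rw [← mulVec_mulVec, dotProduct_mulVec, vecMul_transpose, dotProduct]
    exact Finset.sum_congr rfl fun i _ => by rw [sq]; rfl
  have h2 : (Bᵀ * B).trace = ∑ i, ∑ j, B i j ^ 2 := by
    rw [trace_mul_comm]
    simp [trace, mul_apply, sq]
  rw [h1, h2, Finset.sum_mul]
  refine Finset.sum_le_sum fun i _ => ?_
  have := Finset.sum_mul_sq_le_sq_mul_sq Finset.univ (B i) x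
  simpa [dotProduct, sq] using this

/-- Cauchy-Schwarz for the quadratic form of a positive semidefinite matrix. -/
lemma bilinForm_sq_le {A : Matrix ι ι ℝ} (hA : A.PosSemidef) (x y : ι → ℝ) :
    (x ⬝ᵥ (A *ᵥ y)) ^ 2 ≤ (x ⬝ᵥ (A *ᵥ x)) * (y ⬝ᵥ (A *ᵥ y)) := by
  obtain ⟨B, rfl⟩ := exists_eq_transpose_mul_self hA
  have h (x y : ι → ℝ) : x ⬝ᵥ ((Bᵀ * B) *ᵥ y) = ∑ i, (B *ᵥ x) i * (B *ᵥ y) i := by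
    rw [← mulVec_mulVec, dotProduct_mulVec, vecMul_transpose, dotProduct]
  simp only [h]
  have := Finset.sum_mul_sq_le_sq_mul_sq Finset.univ (B *ᵥ x) (B *ᵥ y)
  simpa [sq] using this

lemma dotProduct_self_le_quadForm [DecidableEq ι] {A : Matrix ι ι ℝ} (hA : A.PosDef)
    (x : ι → ℝ) : x ⬝ᵥ x ≤ A⁻¹.trace * (x ⬝ᵥ (A *ᵥ x)) := by
  have hdet : IsUnit A.det := (isUnit_iff_isUnit_det A).mp hA.isUnit
  have hcs := bilinForm_sq_le hA.posSemidef x (A⁻¹ *ᵥ x)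
  rw [mulVec_mulVec, mul_nonsing_inv A hdet, one_mulVec, dotProduct_comm (A⁻¹ *ᵥ x)] at hcs
  have h1 := quadForm_le_trace_mul hA.inv.posSemidef x
  have h2 : 0 ≤ x ⬝ᵥ (A *ᵥ x) := by
    simpa using hA.posSemidef.dotProduct_mulVec_nonneg x
  have h3 : 0 ≤ x ⬝ᵥ x := by simpa using dotProduct_star_self_nonneg x
  rcases h3.eq_or_lt with h | h
  · rw [← h]; exact mul_nonneg hA.inv.posSemidef.trace_nonneg h2
  · nlinarith [mul_le_mul_of_nonneg_left h1 h2]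

lemma posSemidef_sub_smul_one [DecidableEq ι] {A : Matrix ι ι ℝ} (hA : A.IsSymm) {c : ℝ}
    (h : ∀ x : ι → ℝ, c * (x ⬝ᵥ x) ≤ x ⬝ᵥ (A *ᵥ x)) : (A - c • 1).PosSemidef := by
  refine .of_dotProduct_mulVec_nonneg ?_ fun x => ?_
  · rw [IsHermitian, conjTranspose_eq_transpose_of_trivial]
    simp [hA.eq]
  · simp only [star_trivial, sub_mulVec, smul_mulVec, one_mulVec, dotProduct_sub, dotProduct_smul,
      smul_eq_mul, sub_nonneg]
    exact h x

/-- Comparison of `det Y` with `tr (s Y)`. -/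
lemma det_mul_det_le_exp_trace [DecidableEq ι] {s Y : Matrix ι ι ℝ} (hs : s.PosSemidef)
    (hY : Y.PosSemidef) {η : ℝ} (hη : 0 < η) :
    η ^ Fintype.card ι * (s.det * Y.det) ≤ Real.exp (η * (s * Y).trace) := by
  obtain ⟨B, rfl⟩ := exists_eq_transpose_mul_self hY
  have hp := hs.mul_mul_conjTranspose_same B
  rw [conjTranspose_eq_transpose_of_trivial] at hp
  have htr : (s * (Bᵀ * B)).trace = (B * s * Bᵀ).trace := by
    rw [← Matrix.mul_assoc, trace_mul_comm, ← Matrix.mul_assoc]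
  have hdet : s.det * (Bᵀ * B).det = (B * s * Bᵀ).det := by
    simp only [det_mul, det_transpose]; ring
  rw [htr, hdet, hp.isHermitian.det_eq_prod_eigenvalues, hp.isHermitian.trace_eq_sum_eigenvalues]
  simp only [RCLike.ofReal_real_eq_id, id]
  rw [Finset.mul_sum, Real.exp_sum, ← Finset.card_univ, ← Finset.prod_const,
    ← Finset.prod_mul_distrib]
  refine Finset.prod_le_prod (fun i _ => mul_nonneg hη.le (hp.eigenvalues_nonneg i)) fun i _ => ?_
  linarith [Real.add_one_le_exp (η * hp.isHermitian.eigenvalues i)]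

/-- If `Y ≥ 2 ε`, then `det (Y - ε)` and `det Y` are comparable. -/
lemma det_sub_smul_one_bounds [DecidableEq ι] {Y : Matrix ι ι ℝ} (hY : Y.IsSymm) {ε : ℝ}
    (hε : 0 < ε) (h : (Y - (2 * ε) • 1).PosSemidef) :
    ε ^ Fintype.card ι ≤ (Y - ε • 1).det ∧ (Y - ε • 1).det ≤ Y.det ∧
      Y.det ≤ 2 ^ Fintype.card ι * (Y - ε • 1).det := by
  have hH : Y.IsHermitian := by rwa [IsHermitian, conjTranspose_eq_transpose_of_trivial]
  have hev (i : ι) : 2 * ε ≤ hH.eigenvalues i := by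
    have h1 := h.dotProduct_mulVec_nonneg (hH.eigenvectorBasis i).ofLp
    have h2 := hH.mulVec_eigenvectorBasis i
    have h3 : (hH.eigenvectorBasis i).ofLp ⬝ᵥ (hH.eigenvectorBasis i).ofLp = 1 := by
      have := hH.eigenvectorBasis.orthonormal.1 i
      rw [EuclideanSpace.norm_eq, Real.sqrt_eq_one] at this
      simpa [dotProduct, sq] using this
    simp only [star_trivial, sub_mulVec, smul_mulVec, one_mulVec, h2, dotProduct_sub,
      dotProduct_smul, smul_eq_mul, h3, mul_one, sub_nonneg] at h1
    exact h1
  have hdet : (Y - ε • 1).det = ∏ i, (hH.eigenvalues i - ε) := by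
    have h1 := congrArg (Polynomial.eval ε) hH.charpoly_eq
    rw [Matrix.eval_charpoly, Polynomial.eval_prod] at h1
    have h2 : (Y - ε • 1).det = (-1) ^ Fintype.card ι * (scalar ι ε - Y).det := by
      rw [← det_neg, neg_sub, scalar_apply, ← smul_one_eq_diagonal]
    rw [h2, h1, ← Finset.card_univ, ← Finset.prod_const, ← Finset.prod_mul_distrib]
    exact Finset.prod_congr rfl fun i _ => by simp
  have hdetY : Y.det = ∏ i, hH.eigenvalues i := by
    simpa using hH.det_eq_prod_eigenvalues
  rw [hdet, hdetY, ← Finset.card_univ, ← Finset.prod_const, ← Finset.prod_const,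
    ← Finset.prod_mul_distrib]
  refine ⟨Finset.prod_le_prod (fun i _ => hε.le) fun i _ => ?_,
    Finset.prod_le_prod (fun i _ => ?_) fun i _ => ?_,
    Finset.prod_le_prod (fun i _ => ?_) fun i _ => ?_⟩ <;> linarith [hev i]

end PosSemidef

lemma exists_forall_le_two_mul {α : Type*} [Nonempty α] (f : α → ℝ) {c : ℝ} (hc : 0 < c)
    (h : ∀ a, c ≤ f a) : ∃ a, ∀ b, f a ≤ 2 * f b := by
  have hb : BddBelow (Set.range f) := ⟨c, by rintro _ ⟨a, rfl⟩; exact h a⟩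
  have hpos : 0 < ⨅ a, f a := hc.trans_le (le_ciInf h)
  obtain ⟨a, ha⟩ := exists_lt_of_ciInf_lt (f := f) (show ⨅ a, f a < 2 * ⨅ a, f a by linarith)
  exact ⟨a, fun b => by linarith [ciInf_le hb b]⟩

lemma exists_int_abs_add_mul_le (x : ℝ) {h : ℝ} (hh : 0 < h) :
    ∃ k : ℤ, (x + k * h) ^ 2 / h ≤ h / 4 := by
  refine ⟨-round (x / h), ?_⟩
  have h1 := abs_sub_round (x / h)
  have h2 : x + ((-round (x / h) : ℤ) : ℝ) * h = (x / h - round (x / h)) * h := by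
    push_cast; field_simp; ring
  rw [h2, mul_pow, div_le_iff₀ hh]
  have h3 : (x / h - round (x / h)) ^ 2 ≤ (1 / 2) ^ 2 := sq_le_sq' (abs_le.mp h1).1 (abs_le.mp h1).2
  nlinarith [sq_nonneg h]

end FJ

namespace FJ

open Matrix

section SymplecticReduction

set_option linter.unusedSectionVars false

/-- The value of the quadratic form `Q` at an integral vector. -/
def intQuad {κ : Type*} [Fintype κ] (Q : Matrix κ κ ℝ) (v : κ → ℤ) : ℝ :=
  (fun j => (v j : ℝ)) ⬝ᵥ (Q *ᵥ fun j => (v j : ℝ))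

lemma intQuad_mul {κ : Type*} [Fintype κ] (Q : Matrix κ κ ℝ) (A B : Matrix κ κ ℤ) (i : κ) :
    intQuad Q ((A * B) i) =
      intQuad (B.map (fun x : ℤ => (x : ℝ)) * Q * (B.map (fun x : ℤ => (x : ℝ)))ᵀ) (A i) := by
  have h : (fun j => (((A * B) i j : ℤ) : ℝ)) =
      (fun j => (A i j : ℝ)) ᵥ* B.map (fun x : ℤ => (x : ℝ)) := by
    ext j
    simp [mul_apply, vecMul, dotProduct]
  rw [intQuad, intQuad, h, ← mulVec_mulVec, ← mulVec_mulVec, mulVec_transpose,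
    dotProduct_mulVec _ (B.map _), ← dotProduct_mulVec]

lemma exists_le_intQuad {κ : Type*} [Fintype κ] [Nonempty κ] {Q : Matrix κ κ ℝ}
    (hQ : Q.PosDef) : ∃ c > 0, ∀ v : κ → ℤ, v ≠ 0 → c ≤ intQuad Q v := by
  classical
  have htr : 0 < Q⁻¹.trace := hQ.inv.trace_pos
  refine ⟨(Q⁻¹.trace)⁻¹, inv_pos.mpr htr, fun v hv => ?_⟩
  have h1 := dotProduct_self_le_quadForm hQ fun j => (v j : ℝ)
  have h2 : (1 : ℝ) ≤ (fun j => (v j : ℝ)) ⬝ᵥ fun j => (v j : ℝ) := by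
    have : 0 < v ⬝ᵥ v := by
      obtain ⟨j, hj⟩ := Function.ne_iff.mp hv
      exact Finset.sum_pos' (fun i _ => mul_self_nonneg _) ⟨j, Finset.mem_univ j, by
        exact mul_self_pos.mpr hj⟩
    have h3 : (1 : ℤ) ≤ v ⬝ᵥ v := this
    have h4 : ((v ⬝ᵥ v : ℤ) : ℝ) = (fun j => (v j : ℝ)) ⬝ᵥ fun j => (v j : ℝ) := by
      simp [dotProduct]
    rw [← h4]; exact_mod_cast h3
  rw [inv_le_iff_one_le_mul₀' htr]
  exact h2.trans h1

variable {ι : Type*} [Fintype ι] [DecidableEq ι]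

lemma row_ne_zero_of_mem_symplecticGroup {γ : Matrix (ι ⊕ ι) (ι ⊕ ι) ℤ}
    (hγ : γ ∈ symplecticGroup ι ℤ) (i : ι ⊕ ι) : γ i ≠ 0 := fun h => by
  have := SymplecticGroup.symplectic_det hγ
  rw [det_eq_zero_of_row_eq_zero i fun j => congrFun h j] at this
  exact not_isUnit_zero this

/-- The standard symplectic form. -/
def symp {R : Type*} [CommRing R] (u v : ι ⊕ ι → R) : R := u ⬝ᵥ (J ι R *ᵥ v)

lemma symp_eq_sum {R : Type*} [CommRing R] (u v : ι ⊕ ι → R) :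
    symp u v = ∑ i, (u (.inr i) * v (.inl i) - u (.inl i) * v (.inr i)) := by
  have h : J ι R *ᵥ v = Sum.elim (fun i => -v (.inr i)) (fun i => v (.inl i)) := by
    rw [J, fromBlocks_mulVec]
    ext (i | i) <;> simp [neg_mulVec]
  simp [symp, h, dotProduct, Fintype.sum_sum_type, Finset.sum_sub_distrib]
  ring

lemma symp_skew {R : Type*} [CommRing R] (u v : ι ⊕ ι → R) : symp u v = -symp v u := by
  rw [symp_eq_sum, symp_eq_sum, ← Finset.sum_neg_distrib]
  exact Finset.sum_congr rfl fun i _ => by ring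

lemma symp_sub_smul {R : Type*} [CommRing R] (u v w : ι ⊕ ι → R) (a b : R) :
    symp (u - a • w) (v - b • w) = symp u v - b * symp u w + a * symp v w := by
  have h : symp w w = 0 := by
    rw [symp_eq_sum]; exact Finset.sum_eq_zero fun i _ => by ring
  have h2 := symp_skew w v
  simp only [symp, sub_dotProduct, mulVec_sub, mulVec_smul, dotProduct_sub, dotProduct_smul,
    smul_dotProduct, smul_eq_mul] at h h2 ⊢
  rw [h, h2]; ring

lemma mem_symplecticGroup_iff_symp {R : Type*} [CommRing R] {A : Matrix (ι ⊕ ι) (ι ⊕ ι) R} :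
    A ∈ symplecticGroup ι R ↔ ∀ x y, symp (A x) (A y) = J ι R x y := by
  rw [SymplecticGroup.mem_iff, ← Matrix.ext_iff]
  have h (x y : ι ⊕ ι) : (A * J ι R * Aᵀ) x y = symp (A x) (A y) := by
    rw [Matrix.mul_assoc, mul_apply, symp, dotProduct]; rfl
  simp [h]

lemma levi_mem {R : Type*} [CommRing R] {a d : Matrix ι ι R} (h : aᵀ * d = 1) :
    fromBlocks a 0 0 d ∈ symplecticGroup ι R := by
  simp [SymplecticGroup.fromBlocks_mem_iff, h]

lemma translation_mem {R : Type*} [CommRing R] {b : Matrix ι ι R} (h : b.IsSymm) :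
    fromBlocks 1 b 0 1 ∈ symplecticGroup ι R := by
  simp [SymplecticGroup.fromBlocks_mem_iff, h.eq]

/-- The embedding of index sets of a symplectic lattice into one of genus one higher. -/
def sympIncl : ι ⊕ ι → (ι ⊕ Unit) ⊕ (ι ⊕ Unit) := Sum.map .inl .inl

/-- The index of the last basis vector. -/
abbrev lastE : (ι ⊕ Unit) ⊕ (ι ⊕ Unit) := .inr (.inr ())

/-- The index of the basis vector dual to the last one. -/
abbrev lastF : (ι ⊕ Unit) ⊕ (ι ⊕ Unit) := .inl (.inr ())

lemma symp_sum_unit {R : Type*} [CommRing R] (u v : (ι ⊕ Unit) ⊕ (ι ⊕ Unit) → R) :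
    symp u v = symp (u ∘ sympIncl) (v ∘ sympIncl) +
      (u lastE * v lastF - u lastF * v lastE) := by
  simp only [symp_eq_sum, Fintype.sum_sum_type, sympIncl, Function.comp_apply, Sum.map_inl,
    Sum.map_inr, Finset.univ_unique, Finset.sum_singleton]

/-- The quadratic form induced by `Q` on the orthogonal complement of the last basis vector. -/
noncomputable def schurForm (Q : Matrix ((ι ⊕ Unit) ⊕ (ι ⊕ Unit)) ((ι ⊕ Unit) ⊕ (ι ⊕ Unit)) ℝ) :
    Matrix (ι ⊕ ι) (ι ⊕ ι) ℝ :=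
  of fun x => Q (sympIncl x) ∘ sympIncl -
    (Q (sympIncl x) lastE / Q lastE lastE) • fun y => Q lastE (sympIncl y)

lemma schurForm_row (Q : Matrix ((ι ⊕ Unit) ⊕ (ι ⊕ Unit)) ((ι ⊕ Unit) ⊕ (ι ⊕ Unit)) ℝ)
    (x : ι ⊕ ι) : schurForm Q x = Q (sympIncl x) ∘ sympIncl -
      (Q (sympIncl x) lastE / Q lastE lastE) • (Q lastE ∘ sympIncl) := rfl

variable {Q : Matrix ((ι ⊕ Unit) ⊕ (ι ⊕ Unit)) ((ι ⊕ Unit) ⊕ (ι ⊕ Unit)) ℝ}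

lemma schurForm_mem (hQ : Q ∈ symplecticGroup (ι ⊕ Unit) ℝ) (hs : Q.IsSymm)
    (h0 : Q lastE lastE ≠ 0) : schurForm Q ∈ symplecticGroup ι ℝ := by
  rw [mem_symplecticGroup_iff_symp] at hQ ⊢
  intro x y
  have h1 := hQ (sympIncl x) (sympIncl y)
  have h2 (x : ι ⊕ ι) := hQ (sympIncl x) lastE
  simp only [symp_sum_unit] at h1 h2
  have hJ1 : J (ι ⊕ Unit) ℝ (sympIncl x) (sympIncl y) = J ι ℝ x y := by
    rcases x with x | x <;> rcases y with y | y <;> simp [J, sympIncl, one_apply]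
  have hJ2 (x : ι ⊕ ι) : J (ι ⊕ Unit) ℝ (sympIncl x) lastE = 0 := by
    rcases x with x | x <;> simp [J, sympIncl, one_apply]
  rw [hJ1] at h1
  simp only [hJ2] at h2
  rw [schurForm_row, schurForm_row, symp_sub_smul]
  have e1 := h2 x
  have e2 := h2 y
  have s1 := hs.apply (sympIncl x) lastE
  have s2 := hs.apply (sympIncl y) lastE
  field_simp
  linear_combination Q lastE lastE * h1 - Q (sympIncl y) lastE * e1 + Q (sympIncl x) lastE * e2

lemma quadForm_extend (hs : Q.IsSymm) (h0 : Q lastE lastE ≠ 0) (x : ι ⊕ ι → ℝ) (k : ℝ)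
    (X : (ι ⊕ Unit) ⊕ (ι ⊕ Unit) → ℝ) (hX : X ∘ sympIncl = x) (hf : X lastF = 0)
    (he : X lastE = k) :
    X ⬝ᵥ (Q *ᵥ X) = x ⬝ᵥ (schurForm Q *ᵥ x) +
      ((fun y => Q lastE (sympIncl y)) ⬝ᵥ x + k * Q lastE lastE) ^ 2 / Q lastE lastE := by
  have hsum (w : (ι ⊕ Unit) ⊕ (ι ⊕ Unit) → ℝ) :
      w ⬝ᵥ X = (w ∘ sympIncl) ⬝ᵥ x + k * w lastE := by
    subst hX he
    simp [dotProduct, Fintype.sum_sum_type, sympIncl, hf]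
    ring
  have h1 : X ⬝ᵥ (Q *ᵥ X) = x ⬝ᵥ ((Q *ᵥ X) ∘ sympIncl) + k * (Q *ᵥ X) lastE := by
    rw [dotProduct_comm, hsum, dotProduct_comm]
  have h2 : (Q *ᵥ X) lastE = (fun y => Q lastE (sympIncl y)) ⬝ᵥ x + k * Q lastE lastE := hsum _
  have h3 : (Q *ᵥ X) ∘ sympIncl = schurForm Q *ᵥ x +
      (((fun y => Q lastE (sympIncl y)) ⬝ᵥ x) / Q lastE lastE + k) •
        fun y => Q lastE (sympIncl y) := by
    ext y
    have e1 : (Q *ᵥ X) (sympIncl y) = (Q (sympIncl y) ∘ sympIncl) ⬝ᵥ x + k * Q (sympIncl y) lastE :=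
      hsum _
    have e2 : (schurForm Q *ᵥ x) y = (Q (sympIncl y) ∘ sympIncl) ⬝ᵥ x -
        (Q (sympIncl y) lastE / Q lastE lastE) * ((fun y => Q lastE (sympIncl y)) ⬝ᵥ x) := by
      rw [mulVec]
      simp only [schurForm, of_apply]
      rw [sub_dotProduct, smul_dotProduct, smul_eq_mul]
    simp only [Function.comp_apply, Pi.add_apply, Pi.smul_apply, smul_eq_mul, e1, e2,
      ← hs.apply (sympIncl y) lastE]
    ring
  rw [h1, h2, h3, dotProduct_add, dotProduct_smul,
    dotProduct_comm x (fun y => Q lastE (sympIncl y))]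
  simp only [smul_eq_mul]
  field_simp
  ring

lemma schurForm_isSymm (hs : Q.IsSymm) : (schurForm Q).IsSymm := by
  ext x y
  simp only [schurForm, transpose_apply, of_apply, Pi.sub_apply, Function.comp_apply, Pi.smul_apply,
    smul_eq_mul, hs.apply (sympIncl y) (sympIncl x), hs.apply (sympIncl y) lastE,
    hs.apply (sympIncl x) lastE]
  ring

lemma isSymm_of_posDef {κ : Type*} [Fintype κ] {A : Matrix κ κ ℝ} (h : A.PosDef) : A.IsSymm := by
  have := h.isHermitian
  rwa [IsHermitian, conjTranspose_eq_transpose_of_trivial] at this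

lemma posDef_of_quadForm_pos {κ : Type*} [Fintype κ] {A : Matrix κ κ ℝ} (h : A.IsSymm)
    (hp : ∀ x, x ≠ 0 → 0 < x ⬝ᵥ (A *ᵥ x)) : A.PosDef :=
  .of_dotProduct_mulVec_pos (by rwa [IsHermitian, conjTranspose_eq_transpose_of_trivial])
    fun x hx => by simpa using hp x hx

lemma quadForm_pos {κ : Type*} [Fintype κ] {A : Matrix κ κ ℝ} (h : A.PosDef) {x : κ → ℝ}
    (hx : x ≠ 0) : 0 < x ⬝ᵥ (A *ᵥ x) := by
  simpa using h.dotProduct_mulVec_pos hx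

lemma schurForm_posDef (hQ : Q.PosDef) : (schurForm Q).PosDef := by
  have hs := isSymm_of_posDef hQ
  have h0 : Q lastE lastE ≠ 0 := hQ.diag_pos.ne'
  refine posDef_of_quadForm_pos (schurForm_isSymm hs) fun x hx => ?_
  let X : (ι ⊕ Unit) ⊕ (ι ⊕ Unit) → ℝ :=
    Sum.elim (Sum.elim (x ∘ .inl) 0) (Sum.elim (x ∘ .inr)
      fun _ => -((fun y => Q lastE (sympIncl y)) ⬝ᵥ x) / Q lastE lastE)
  have hX : X ∘ sympIncl = x := by ext (i | i) <;> rfl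
  have hX0 : X ≠ 0 := fun h => hx <| by rw [← hX, h]; rfl
  have h1 := quadForm_extend hs h0 x _ X hX rfl rfl
  have h2 := quadForm_pos hQ hX0
  rw [h1] at h2
  simp only [X, Sum.elim_inr] at h2
  rwa [div_mul_cancel₀ _ h0, add_neg_cancel, zero_pow two_ne_zero, zero_div, add_zero] at h2

/-- Reduction theory for integral symplectic groups: positive definite symplectic matrices
have an integral symplectic basis half of which is uniformly short. -/
def HasSymplecticReduction (ι : Type*) [Fintype ι] [DecidableEq ι] : Prop :=
  ∃ C : ℝ, 0 < C ∧ ∀ Q ∈ symplecticGroup ι ℝ, Q.PosDef →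
    ∃ γ ∈ symplecticGroup ι ℤ, ∀ i, intQuad Q (γ (.inr i)) ≤ C

lemma exists_near_minimal {κ : Type*} [Fintype κ] [DecidableEq κ] {Q : Matrix (κ ⊕ κ) (κ ⊕ κ) ℝ}
    (hQ : Q.PosDef) (i : κ ⊕ κ) : ∃ γ ∈ symplecticGroup κ ℤ, ∀ γ' ∈ symplecticGroup κ ℤ,
      intQuad Q (γ i) ≤ 2 * intQuad Q (γ' i) := by
  have : Nonempty (κ ⊕ κ) := ⟨i⟩
  obtain ⟨c, hc, h⟩ := exists_le_intQuad hQ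
  obtain ⟨γ, hγ⟩ := exists_forall_le_two_mul
    (fun γ : symplecticGroup κ ℤ => intQuad Q (γ.1 i)) hc
    fun γ => h _ (row_ne_zero_of_mem_symplecticGroup γ.2 i)
  exact ⟨γ.1, γ.2, fun γ' hγ' => hγ ⟨γ', hγ'⟩⟩

lemma map_mem_symplecticGroup {κ : Type*} [Fintype κ] [DecidableEq κ]
    {γ : Matrix (κ ⊕ κ) (κ ⊕ κ) ℤ} (h : γ ∈ symplecticGroup κ ℤ) :
    γ.map (fun x : ℤ => (x : ℝ)) ∈ symplecticGroup κ ℝ :=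
  SymplecticGroup.map_mem h (Int.castRingHom ℝ)

lemma posDef_conj {κ : Type*} [Fintype κ] [DecidableEq κ] {Q : Matrix (κ ⊕ κ) (κ ⊕ κ) ℝ}
    (hQ : Q.PosDef) {γ : Matrix (κ ⊕ κ) (κ ⊕ κ) ℝ} (h : γ ∈ symplecticGroup κ ℝ) :
    (γ * Q * γᵀ).PosDef := by
  have hu : IsUnit γ := (isUnit_iff_isUnit_det γ).mpr (SymplecticGroup.symplectic_det h)
  have := (IsUnit.posDef_star_right_conjugate_iff (x := Q) hu).mpr hQ
  rwa [star_eq_conjTranspose, conjTranspose_eq_transpose_of_trivial] at this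

lemma intQuad_one {κ : Type*} [Fintype κ] [DecidableEq κ] (Q : Matrix κ κ ℝ) (i : κ) :
    intQuad Q ((1 : Matrix κ κ ℤ) i) = Q i i := by
  have : (fun j => (((1 : Matrix κ κ ℤ) i j : ℤ) : ℝ)) = Pi.single i 1 := by
    ext j
    rcases eq_or_ne i j with rfl | h
    · simp
    · simp [h, h.symm]
  simp [intQuad, this]

/-- It suffices to reduce forms whose last diagonal entry is nearly minimal in its orbit. -/
lemma exists_near_minimal_form {κ : Type*} [Fintype κ] [DecidableEq κ]
    {Q : Matrix (κ ⊕ κ) (κ ⊕ κ) ℝ} (hQ : Q.PosDef) (hQs : Q ∈ symplecticGroup κ ℝ) (i : κ ⊕ κ) :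
    ∃ γ₀ ∈ symplecticGroup κ ℤ, ∃ R ∈ symplecticGroup κ ℝ, R.PosDef ∧
      (∀ (γ : Matrix (κ ⊕ κ) (κ ⊕ κ) ℤ) j, intQuad Q ((γ * γ₀) j) = intQuad R (γ j)) ∧
      ∀ γ ∈ symplecticGroup κ ℤ, R i i ≤ 2 * intQuad R (γ i) := by
  obtain ⟨γ₀, hγ₀, hmin⟩ := exists_near_minimal hQ i
  have h1 := map_mem_symplecticGroup hγ₀
  refine ⟨γ₀, hγ₀, _, mul_mem (mul_mem h1 hQs) (SymplecticGroup.transpose_mem h1),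
    posDef_conj hQ h1, fun γ j => intQuad_mul Q γ γ₀ j, fun γ hγ => ?_⟩
  rw [← intQuad_one (_ * _ * _), ← intQuad_mul, ← intQuad_mul, one_mul]
  exact hmin _ (mul_mem hγ hγ₀)

lemma hasSymplecticReduction_of_unique [Unique ι] : HasSymplecticReduction ι := by
  refine ⟨2, two_pos, fun Q hQs hQ => ?_⟩
  obtain ⟨γ₀, hγ₀, R, hRs, hR, hmul, hmin⟩ :=
    exists_near_minimal_form hQ hQs (.inr default)
  refine ⟨γ₀, hγ₀, fun i => ?_⟩
  rw [Unique.eq_default i, ← one_mul γ₀, hmul, intQuad_one]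
  set h := R (.inr default) (.inr default) with hh
  have hpos : 0 < h := hR.diag_pos
  obtain ⟨k, hk⟩ := exists_int_abs_add_mul_le (R (.inl default) (.inr default)) hpos
  have hdet := (mem_symplecticGroup_iff_symp.mp hRs) (.inr default) (.inl default)
  have hs := (isSymm_of_posDef hR).apply (.inl default) (.inr default)
  simp [symp_eq_sum, J] at hdet
  have hmem : J ι ℤ * fromBlocks 1 (diagonal fun _ => k) 0 1 ∈ symplecticGroup ι ℤ :=
    mul_mem (SymplecticGroup.J_mem ι ℤ) (translation_mem (isSymm_diagonal _))
  have h1 := hmin _ hmem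
  have h2 : (fun j => (((J ι ℤ * fromBlocks 1 (diagonal fun _ => k) 0 1 : Matrix _ _ ℤ) (.inr default) j : ℤ) : ℝ)) =
      Sum.elim (fun _ => 1) fun _ => (k : ℝ) := by
    ext (j | j) <;> rw [Unique.eq_default j] <;> simp [J, fromBlocks_multiply]
  have h3 : intQuad R ((J ι ℤ * fromBlocks 1 (diagonal fun _ => k) 0 1 : Matrix _ _ ℤ) (.inr default)) =
      1 / h + (R (.inl default) (.inr default) + k * h) ^ 2 / h := by
    rw [intQuad, h2]
    simp [dotProduct, mulVec, Fintype.sum_sum_type]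
    rw [hs] at *
    rw [← hh] at *
    field_simp
    linear_combination hdet
  rw [h3] at h1
  have h4 : h ≤ 2 * (1 / h + h / 4) := h1.trans (by linarith)
  field_simp at h4
  nlinarith

/-- The embedding of symplectic groups extending by the identity. -/
def sympExtend {R : Type*} [CommRing R] (γ : Matrix (ι ⊕ ι) (ι ⊕ ι) R) :
    Matrix ((ι ⊕ Unit) ⊕ (ι ⊕ Unit)) ((ι ⊕ Unit) ⊕ (ι ⊕ Unit)) R :=
  fromBlocks (fromBlocks γ.toBlocks₁₁ 0 0 1) (fromBlocks γ.toBlocks₁₂ 0 0 0)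
    (fromBlocks γ.toBlocks₂₁ 0 0 0) (fromBlocks γ.toBlocks₂₂ 0 0 1)

lemma sympExtend_mem {R : Type*} [CommRing R] {γ : Matrix (ι ⊕ ι) (ι ⊕ ι) R}
    (h : γ ∈ symplecticGroup ι R) : sympExtend γ ∈ symplecticGroup (ι ⊕ Unit) R := by
  rw [← fromBlocks_toBlocks γ, SymplecticGroup.fromBlocks_mem_iff] at h
  obtain ⟨h1, h2, h3⟩ := h
  rw [sympExtend, SymplecticGroup.fromBlocks_mem_iff]
  simp [fromBlocks_transpose, fromBlocks_multiply, h1, h2]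
  rw [sub_eq_add_neg, fromBlocks_neg, fromBlocks_add]
  simp [← sub_eq_add_neg, h3]

lemma HasSymplecticReduction.sum_unit [Nonempty ι] (hι : HasSymplecticReduction ι) :
    HasSymplecticReduction (ι ⊕ Unit) := by
  obtain ⟨C, hC, hred⟩ := hι
  refine ⟨4 * C, by positivity, fun Q hQs hQ => ?_⟩
  obtain ⟨γ₀, hγ₀, R, hRs, hR, hmul, hmin⟩ := exists_near_minimal_form hQ hQs lastE
  have hpos : 0 < R lastE lastE := hR.diag_pos
  have hsymm := isSymm_of_posDef hR
  obtain ⟨γ, hγ, hγC⟩ := hred _ (schurForm_mem hRs hsymm hpos.ne') (schurForm_posDef hR)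
  choose k hk using fun i : ι => exists_int_abs_add_mul_le
    ((fun y => R lastE (sympIncl y)) ⬝ᵥ fun j => (γ (.inr i) j : ℝ)) hpos
  let a : Matrix (ι ⊕ Unit) (ι ⊕ Unit) ℤ := fromBlocks 1 0 (of fun _ i => -k i) 1
  let d : Matrix (ι ⊕ Unit) (ι ⊕ Unit) ℤ := fromBlocks 1 (of fun i _ => k i) 0 1
  have had : aᵀ * d = 1 := by
    simp only [a, d, fromBlocks_transpose, fromBlocks_multiply, ← fromBlocks_one]
    congr 1 <;> ext i j <;> simp [one_apply]
  let H := fromBlocks a 0 0 d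
  have hG : H * sympExtend γ ∈ symplecticGroup (ι ⊕ Unit) ℤ :=
    mul_mem (levi_mem had) (sympExtend_mem hγ)
  have hbound (i : ι) : intQuad R ((H * sympExtend γ) (.inr (.inl i))) ≤
      C + R lastE lastE / 4 := by
    rw [intQuad, quadForm_extend hsymm hpos.ne' (fun j => (γ (.inr i) j : ℝ)) (k i)]
    · exact add_le_add (hγC i) (hk i)
    · ext (j | j) <;> simp [H, d, sympExtend, fromBlocks_multiply, sympIncl, toBlocks₂₁, toBlocks₂₂]
    · simp [H, d, sympExtend, fromBlocks_multiply]
    · simp [H, d, sympExtend, fromBlocks_multiply]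
  have hlast : intQuad R ((H * sympExtend γ) lastE) = R lastE lastE := by
    have : (H * sympExtend γ) lastE =
        (1 : Matrix ((ι ⊕ Unit) ⊕ (ι ⊕ Unit)) ((ι ⊕ Unit) ⊕ (ι ⊕ Unit)) ℤ) lastE := by
      ext ((j | j) | (j | j)) <;> simp [H, d, sympExtend, fromBlocks_multiply, one_apply]
    rw [this, intQuad_one]
  have hh : R lastE lastE ≤ 4 * C := by
    obtain ⟨i⟩ := ‹Nonempty ι›
    let σ : Equiv.Perm (ι ⊕ Unit) := Equiv.swap (.inl i) (.inr ())
    let p : Matrix (ι ⊕ Unit) (ι ⊕ Unit) ℤ := (1 : Matrix _ _ ℤ).submatrix σ id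
    have hp : pᵀ * p = 1 := by
      simp only [p, transpose_submatrix, transpose_one, submatrix_mul_equiv, mul_one,
        submatrix_id_id]
    have h1 := hmin _ (mul_mem (levi_mem hp) hG)
    have h2 : (fromBlocks p 0 0 p * (H * sympExtend γ)) lastE =
        (H * sympExtend γ) (.inr (.inl i)) := by
      ext j
      rw [mul_apply, Fintype.sum_sum_type]
      simp [σ, p, one_apply]
    rw [h2] at h1
    linarith [hbound i]
  refine ⟨H * sympExtend γ * γ₀, mul_mem hG hγ₀, ?_⟩
  rintro (i | i)
  · rw [hmul]
    linarith [hbound i]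
  · rw [hmul]
    exact hlast.trans_le hh

lemma HasSymplecticReduction.of_equiv {κ : Type*} [Fintype κ] [DecidableEq κ] (e : ι ≃ κ)
    (h : HasSymplecticReduction ι) : HasSymplecticReduction κ := by
  obtain ⟨C, hC, hred⟩ := h
  let E : ι ⊕ ι ≃ κ ⊕ κ := Equiv.sumCongr e e
  have hJ (R : Type) [CommRing R] : (J κ R).submatrix E E = J ι R := by
    ext (i | i) (j | j) <;> simp [J, E, one_apply]
  have hmem {R : Type} [CommRing R] {A : Matrix (κ ⊕ κ) (κ ⊕ κ) R}
      (hA : A ∈ symplecticGroup κ R) : A.submatrix E E ∈ symplecticGroup ι R := by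
    rw [SymplecticGroup.mem_iff] at hA ⊢
    rw [← hJ, transpose_submatrix, submatrix_mul_equiv, submatrix_mul_equiv, hA]
  have hmem' {R : Type} [CommRing R] {A : Matrix (ι ⊕ ι) (ι ⊕ ι) R}
      (hA : A ∈ symplecticGroup ι R) : A.submatrix E.symm E.symm ∈ symplecticGroup κ R := by
    rw [SymplecticGroup.mem_iff] at hA ⊢
    have : J κ R = (J ι R).submatrix E.symm E.symm := by rw [← hJ]; simp
    rw [this, transpose_submatrix, submatrix_mul_equiv, submatrix_mul_equiv, hA]
  refine ⟨C, hC, fun Q hQs hQ => ?_⟩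
  obtain ⟨γ, hγ, hb⟩ := hred _ (hmem hQs) (hQ.submatrix E.injective)
  refine ⟨_, hmem' hγ, fun i => ?_⟩
  convert hb (e.symm i) using 1
  simp only [intQuad, submatrix_apply]
  rw [dotProduct, dotProduct, ← E.sum_comp]
  refine Finset.sum_congr rfl fun j _ => ?_
  rw [mulVec, mulVec, dotProduct, dotProduct, ← E.sum_comp]
  simp [E]

theorem hasSymplecticReduction_fin {n : ℕ} (hn : 1 ≤ n) : HasSymplecticReduction (Fin n) := by
  induction n, hn using Nat.le_induction with
  | base => exact hasSymplecticReduction_of_unique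
  | succ n hn ih =>
    have : Nonempty (Fin n) := ⟨⟨0, hn⟩⟩
    exact ih.sum_unit.of_equiv ((Equiv.sumCongr (.refl _) finOneEquiv.symm).trans finSumFinEquiv)

end SymplecticReduction

end FJ

namespace FJ

open Matrix

section SiegelAction

open scoped ComplexOrder

variable {n : ℕ}

/-- A real matrix, regarded as a complex matrix. -/
def toComplex {ι κ : Type*} (A : Matrix ι κ ℝ) : Matrix ι κ ℂ := A.map Complex.ofRealHom

section ToComplex

variable {ι : Type*} [Fintype ι]

lemma toComplex_apply {ι κ : Type*} (A : Matrix ι κ ℝ) (i : ι) (j : κ) :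
    toComplex A i j = (A i j : ℂ) := rfl

lemma toComplex_mul {ν ι κ : Type*} [Fintype ι] (A : Matrix ν ι ℝ) (B : Matrix ι κ ℝ) :
    toComplex (A * B) = toComplex A * toComplex B := Matrix.map_mul

lemma toComplex_add {ι κ : Type*} (A B : Matrix ι κ ℝ) :
    toComplex (A + B) = toComplex A + toComplex B := by ext; simp [toComplex]

lemma toComplex_one {ι : Type*} [DecidableEq ι] : toComplex (1 : Matrix ι ι ℝ) = 1 := by
  simp [toComplex]

lemma toComplex_injective {ι κ : Type*} {A B : Matrix ι κ ℝ} (h : toComplex A = toComplex B) :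
    A = B := by
  ext i j
  exact Complex.ofReal_injective (congrFun (congrFun h i) j)

lemma toComplex_conjTranspose {ι κ : Type*} (A : Matrix ι κ ℝ) :
    (toComplex A)ᴴ = toComplex Aᵀ := by
  ext i j; simp [toComplex_apply]

lemma toComplex_inv [DecidableEq ι] {A : Matrix ι ι ℝ} (hA : IsUnit A.det) :
    toComplex A⁻¹ = (toComplex A)⁻¹ := by
  refine (inv_eq_right_inv ?_).symm
  rw [← toComplex_mul, mul_nonsing_inv A hA, toComplex_one]

lemma toComplex_det [DecidableEq ι] (A : Matrix ι ι ℝ) : (toComplex A).det = (A.det : ℂ) :=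
  (RingHom.map_det Complex.ofRealHom A).symm

lemma posDef_toComplex {A : Matrix ι ι ℝ} (hA : A.PosDef) : (toComplex A).PosDef := by
  classical
  obtain ⟨B, rfl⟩ := exists_eq_transpose_mul_self hA.posSemidef
  have hB : IsUnit B.det := by
    have := (isUnit_iff_isUnit_det _).mp hA.isUnit
    rw [det_mul] at this
    exact isUnit_of_mul_isUnit_right this
  rw [toComplex_mul, ← toComplex_conjTranspose]
  refine PosDef.conjTranspose_mul_self _ (mulVec_injective_iff_isUnit.mpr ?_)
  rw [isUnit_iff_isUnit_det, toComplex_det]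
  simpa using hB

lemma posDef_of_toComplex {A : Matrix ι ι ℝ} (hA : (toComplex A).PosDef) : A.PosDef := by
  have hs : A.IsSymm := toComplex_injective <| by
    rw [← toComplex_conjTranspose]; exact hA.isHermitian
  refine posDef_of_quadForm_pos hs fun x hx => ?_
  have h := hA.dotProduct_mulVec_pos (x := fun i => (x i : ℂ)) fun h => hx <| by
    ext i; simpa using congrFun h i
  have h2 : star (fun i => (x i : ℂ)) ⬝ᵥ (toComplex A *ᵥ fun i => (x i : ℂ)) =
      ((x ⬝ᵥ (A *ᵥ x) : ℝ) : ℂ) := by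
    simp [dotProduct, mulVec, toComplex_apply]
  rw [h2] at h
  exact_mod_cast h

end ToComplex

/-- The action of `γ` on the Siegel upper half space. -/
noncomputable def smulSiegel (γ : Matrix (Fin n ⊕ Fin n) (Fin n ⊕ Fin n) ℤ)
    (τ : Matrix (Fin n) (Fin n) ℂ) : Matrix (Fin n) (Fin n) ℂ :=
  num γ τ * (denom γ τ)⁻¹

lemma isSymm_imMat {ι : Type*} {τ : Matrix ι ι ℂ} (h : τ.IsSymm) : (imMat τ).IsSymm := by
  ext i j; simp [imMat, h.apply]

lemma sub_conjTranspose_eq {ι : Type*} {τ : Matrix ι ι ℂ} (h : τ.IsSymm) :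
    τ - τᴴ = (2 * Complex.I) • toComplex (imMat τ) := by
  ext i j
  simp only [Matrix.sub_apply, conjTranspose_apply, Matrix.smul_apply, smul_eq_mul, toComplex_apply, imMat,
    map_apply, h.apply, Complex.star_def]
  rw [Complex.sub_conj]; push_cast; ring

/-- Entrywise cast of an integral matrix to a complex one. -/
abbrev intC {ι κ : Type*} (A : Matrix ι κ ℤ) : Matrix ι κ ℂ := A.map (fun x : ℤ => (x : ℂ))

lemma intC_conjTranspose {ι κ : Type*} (A : Matrix ι κ ℤ) : (intC A)ᴴ = (intC A)ᵀ := by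
  ext; simp

section Symplectic

variable {γ : Matrix (Fin n ⊕ Fin n) (Fin n ⊕ Fin n) ℤ}

lemma symplectic_relations (hγ : γ ∈ symplecticGroup (Fin n) ℤ) :
    (intC γ.toBlocks₁₁)ᵀ * intC γ.toBlocks₂₁ = (intC γ.toBlocks₂₁)ᵀ * intC γ.toBlocks₁₁ ∧
    (intC γ.toBlocks₁₂)ᵀ * intC γ.toBlocks₂₂ = (intC γ.toBlocks₂₂)ᵀ * intC γ.toBlocks₁₂ ∧
    (intC γ.toBlocks₁₁)ᵀ * intC γ.toBlocks₂₂ - (intC γ.toBlocks₂₁)ᵀ * intC γ.toBlocks₁₂ = 1 := by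
  have h : γ.map (Int.castRingHom ℂ) ∈ symplecticGroup (Fin n) ℂ :=
    SymplecticGroup.map_mem hγ (Int.castRingHom ℂ)
  rw [← fromBlocks_toBlocks (γ.map (Int.castRingHom ℂ)), SymplecticGroup.fromBlocks_mem_iff] at h
  exact h

lemma symplectic_relations' (hγ : γ ∈ symplecticGroup (Fin n) ℤ) :
    intC γ.toBlocks₁₁ * (intC γ.toBlocks₁₂)ᵀ = intC γ.toBlocks₁₂ * (intC γ.toBlocks₁₁)ᵀ ∧
    intC γ.toBlocks₂₁ * (intC γ.toBlocks₂₂)ᵀ = intC γ.toBlocks₂₂ * (intC γ.toBlocks₂₁)ᵀ ∧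
    intC γ.toBlocks₁₁ * (intC γ.toBlocks₂₂)ᵀ - intC γ.toBlocks₁₂ * (intC γ.toBlocks₂₁)ᵀ = 1 := by
  have h := symplectic_relations (SymplecticGroup.transpose_mem hγ)
  exact h

lemma num_transpose_mul_denom (hγ : γ ∈ symplecticGroup (Fin n) ℤ)
    {τ : Matrix (Fin n) (Fin n) ℂ} (hτ : τ.IsSymm) :
    (num γ τ)ᵀ * denom γ τ = (denom γ τ)ᵀ * num γ τ := by
  obtain ⟨h1, h2, h3⟩ := symplectic_relations hγ
  have h3' := congrArg transpose h3
  rw [transpose_sub, transpose_mul, transpose_mul, transpose_transpose, transpose_transpose,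
    transpose_one] at h3'
  simp only [num, denom, transpose_add, transpose_mul, hτ.eq]
  linear_combination (norm := noncomm_ring) τ * h1 * τ + h2 + τ * h3 - h3' * τ

lemma denom_conjTranspose_mul_num (hγ : γ ∈ symplecticGroup (Fin n) ℤ)
    (τ : Matrix (Fin n) (Fin n) ℂ) :
    (denom γ τ)ᴴ * num γ τ - (num γ τ)ᴴ * denom γ τ = τ - τᴴ := by
  obtain ⟨h1, h2, h3⟩ := symplectic_relations hγ
  have h3' := congrArg transpose h3
  rw [transpose_sub, transpose_mul, transpose_mul, transpose_transpose, transpose_transpose,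
    transpose_one] at h3'
  simp only [num, denom, conjTranspose_add, conjTranspose_mul, intC_conjTranspose]
  linear_combination (norm := noncomm_ring) - τᴴ * h1 * τ - h2 - τᴴ * h3 + h3' * τ

lemma isUnit_det_denom (hγ : γ ∈ symplecticGroup (Fin n) ℤ) {τ : Matrix (Fin n) (Fin n) ℂ}
    (hτ : τ ∈ siegelUpperHalf (Fin n)) : IsUnit (denom γ τ).det := by
  rw [isUnit_iff_ne_zero]
  intro h0
  obtain ⟨x, hx, hDx⟩ := exists_mulVec_eq_zero_iff.mpr h0
  have h1 := denom_conjTranspose_mul_num hγ τ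
  rw [sub_conjTranspose_eq hτ.1] at h1
  have h2 := congrArg (fun A => star x ⬝ᵥ (A *ᵥ x)) h1
  simp only [sub_mulVec, ← mulVec_mulVec, hDx, mulVec_zero, sub_zero, smul_mulVec, dotProduct_smul,
    smul_eq_mul] at h2
  rw [dotProduct_mulVec, vecMul_conjTranspose, star_star, hDx, star_zero, zero_dotProduct] at h2
  have h3 := (posDef_toComplex hτ.2).dotProduct_mulVec_pos hx
  rcases mul_eq_zero.mp h2.symm with h | h
  · simp at h
  · exact h3.ne' h

lemma smulSiegel_isSymm (hγ : γ ∈ symplecticGroup (Fin n) ℤ) {τ : Matrix (Fin n) (Fin n) ℂ}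
    (hτ : τ ∈ siegelUpperHalf (Fin n)) : (smulSiegel γ τ).IsSymm := by
  have hD := isUnit_det_denom hγ hτ
  have hDt : IsUnit (denom γ τ)ᵀ.det := by rwa [det_transpose]
  rw [IsSymm, smulSiegel, transpose_mul, transpose_nonsing_inv]
  calc (denom γ τ)ᵀ⁻¹ * (num γ τ)ᵀ
      = (denom γ τ)ᵀ⁻¹ * ((num γ τ)ᵀ * denom γ τ) * (denom γ τ)⁻¹ := by
        rw [Matrix.mul_assoc, Matrix.mul_assoc, mul_nonsing_inv _ hD, mul_one]
    _ = num γ τ * (denom γ τ)⁻¹ := by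
        rw [num_transpose_mul_denom hγ hτ.1, ← Matrix.mul_assoc, nonsing_inv_mul _ hDt, one_mul]

lemma imMat_smulSiegel (hγ : γ ∈ symplecticGroup (Fin n) ℤ) {τ : Matrix (Fin n) (Fin n) ℂ}
    (hτ : τ ∈ siegelUpperHalf (Fin n)) :
    toComplex (imMat (smulSiegel γ τ)) =
      ((denom γ τ)⁻¹)ᴴ * toComplex (imMat τ) * (denom γ τ)⁻¹ := by
  have hD := isUnit_det_denom hγ hτ
  have hDc : IsUnit (denom γ τ)ᴴ.det := by rw [det_conjTranspose]; exact hD.star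
  have h1 := sub_conjTranspose_eq (smulSiegel_isSymm hγ hτ)
  have h2 := denom_conjTranspose_mul_num hγ τ
  rw [sub_conjTranspose_eq hτ.1] at h2
  have h3 : smulSiegel γ τ - (smulSiegel γ τ)ᴴ = ((denom γ τ)⁻¹)ᴴ *
      ((denom γ τ)ᴴ * num γ τ - (num γ τ)ᴴ * denom γ τ) * (denom γ τ)⁻¹ := by
    rw [smulSiegel, conjTranspose_mul, conjTranspose_nonsing_inv, Matrix.mul_sub, Matrix.sub_mul,
      ← Matrix.mul_assoc, nonsing_inv_mul _ hDc, one_mul, Matrix.mul_assoc, Matrix.mul_assoc,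
      mul_nonsing_inv _ hD, mul_one]
  rw [h2, h1, Matrix.mul_smul, Matrix.smul_mul] at h3
  exact smul_right_injective _ (by simp : (2 * Complex.I : ℂ) ≠ 0) h3

lemma smulSiegel_mem (hγ : γ ∈ symplecticGroup (Fin n) ℤ) {τ : Matrix (Fin n) (Fin n) ℂ}
    (hτ : τ ∈ siegelUpperHalf (Fin n)) : smulSiegel γ τ ∈ siegelUpperHalf (Fin n) := by
  refine ⟨smulSiegel_isSymm hγ hτ, posDef_of_toComplex ?_⟩
  rw [imMat_smulSiegel hγ hτ]
  refine (posDef_toComplex hτ.2).conjTranspose_mul_mul_same (mulVec_injective_iff_isUnit.mpr ?_)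
  rw [isUnit_iff_isUnit_det]
  exact isUnit_nonsing_inv_det _ (isUnit_det_denom hγ hτ)

lemma det_imMat_smulSiegel (hγ : γ ∈ symplecticGroup (Fin n) ℤ) {τ : Matrix (Fin n) (Fin n) ℂ}
    (hτ : τ ∈ siegelUpperHalf (Fin n)) :
    (imMat (smulSiegel γ τ)).det = (imMat τ).det / ‖(denom γ τ).det‖ ^ 2 := by
  have h := congrArg det (imMat_smulSiegel hγ hτ)
  rw [toComplex_det, det_mul, det_mul, toComplex_det, det_conjTranspose, det_nonsing_inv,
    Ring.inverse_eq_inv'] at h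
  have h2 := congrArg norm h
  have p1 := (smulSiegel_mem hγ hτ).2.det_pos
  have p2 := hτ.2.det_pos
  simp only [norm_mul, norm_star, norm_inv, Complex.norm_real, Real.norm_eq_abs, abs_of_pos p1,
    abs_of_pos p2] at h2
  rw [h2]; ring

lemma imMat_smulSiegel_inv (hγ : γ ∈ symplecticGroup (Fin n) ℤ)
    {τ : Matrix (Fin n) (Fin n) ℂ} (hτ : τ ∈ siegelUpperHalf (Fin n)) :
    toComplex (imMat (smulSiegel γ τ))⁻¹ =
      denom γ τ * toComplex (imMat τ)⁻¹ * (denom γ τ)ᴴ := by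
  have hD := isUnit_det_denom hγ hτ
  have hDc : IsUnit (denom γ τ)ᴴ.det := by rw [det_conjTranspose]; exact hD.star
  have hY : IsUnit (imMat τ).det := hτ.2.det_pos.ne'.isUnit
  rw [toComplex_inv (smulSiegel_mem hγ hτ).2.det_pos.ne'.isUnit, imMat_smulSiegel hγ hτ,
    Matrix.mul_inv_rev, Matrix.mul_inv_rev, nonsing_inv_nonsing_inv _ hD, conjTranspose_nonsing_inv,
    nonsing_inv_nonsing_inv _ hDc, toComplex_inv hY, Matrix.mul_assoc]

end Symplectic

end SiegelAction

end FJ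

namespace FJ

open Matrix

section SiegelReduction

open scoped ComplexOrder

variable {n : ℕ} {γ : Matrix (Fin n ⊕ Fin n) (Fin n ⊕ Fin n) ℤ}

/-- Entrywise real part of a complex matrix. -/
def reMat {ι : Type*} (τ : Matrix ι ι ℂ) : Matrix ι ι ℝ := τ.map Complex.re

lemma eq_reMat_add_imMat {ι : Type*} (τ : Matrix ι ι ℂ) :
    τ = toComplex (reMat τ) + Complex.I • toComplex (imMat τ) := by
  ext i j
  simp [toComplex_apply, reMat, imMat, mul_comm Complex.I, Complex.re_add_im]

/-- The symplectic quadratic form attached to a point of the Siegel upper half space. -/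
noncomputable def siegelForm {ι : Type*} [Fintype ι] [DecidableEq ι] (τ : Matrix ι ι ℂ) :
    Matrix (ι ⊕ ι) (ι ⊕ ι) ℝ :=
  fromBlocks 1 (reMat τ) 0 1 * fromBlocks (imMat τ) 0 0 (imMat τ)⁻¹ *
    (fromBlocks 1 (reMat τ) 0 1)ᵀ

section

variable {ι : Type*} [Fintype ι] [DecidableEq ι] {τ : Matrix ι ι ℂ}

lemma translation_reMat_mem (hτ : τ ∈ siegelUpperHalf ι) :
    fromBlocks 1 (reMat τ) 0 1 ∈ symplecticGroup ι ℝ :=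
  translation_mem (by ext i j; simp [reMat, hτ.1.apply])

lemma siegelForm_mem (hτ : τ ∈ siegelUpperHalf ι) : siegelForm τ ∈ symplecticGroup ι ℝ := by
  have h1 := translation_reMat_mem hτ
  refine mul_mem (mul_mem h1 (levi_mem ?_)) (SymplecticGroup.transpose_mem h1)
  rw [(isSymm_imMat hτ.1).eq, mul_nonsing_inv _ hτ.2.det_pos.ne'.isUnit]

lemma siegelForm_posDef (hτ : τ ∈ siegelUpperHalf ι) : (siegelForm τ).PosDef := by
  refine posDef_conj (posDef_of_quadForm_pos ?_ fun x hx => ?_) (translation_reMat_mem hτ)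
  · exact IsSymm.fromBlocks (isSymm_imMat hτ.1) (by simp) (isSymm_of_posDef hτ.2.inv)
  · obtain ⟨u, v, rfl⟩ : ∃ u v, x = Sum.elim u v := ⟨_, _, (Sum.elim_comp_inl_inr x).symm⟩
    have hu : 0 ≤ u ⬝ᵥ (imMat τ *ᵥ u) := by
      simpa using hτ.2.posSemidef.dotProduct_mulVec_nonneg u
    have hv : 0 ≤ v ⬝ᵥ ((imMat τ)⁻¹ *ᵥ v) := by
      simpa using hτ.2.inv.posSemidef.dotProduct_mulVec_nonneg v
    simp only [fromBlocks_mulVec, Sum.elim_comp_inl, Sum.elim_comp_inr, zero_mulVec, add_zero,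
      zero_add, sumElim_dotProduct_sumElim]
    by_cases hu0 : u = 0
    · have hv0 : v ≠ 0 := by
        rintro rfl
        exact hx (by rw [hu0]; ext (i | i) <;> rfl)
      exact add_pos_of_nonneg_of_pos hu (quadForm_pos hτ.2.inv hv0)
    · exact add_pos_of_pos_of_nonneg (quadForm_pos hτ.2 hu0) hv

end

lemma imMat_smulSiegel_inv_apply (hγ : γ ∈ symplecticGroup (Fin n) ℤ)
    {τ : Matrix (Fin n) (Fin n) ℂ} (hτ : τ ∈ siegelUpperHalf (Fin n)) (i : Fin n) :
    (imMat (smulSiegel γ τ))⁻¹ i i = intQuad (siegelForm τ) (γ (.inr i)) := by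
  set c : Matrix (Fin n) (Fin n) ℝ := γ.toBlocks₂₁.map (fun x : ℤ => (x : ℝ)) with hc
  set d : Matrix (Fin n) (Fin n) ℝ := γ.toBlocks₂₂.map (fun x : ℤ => (x : ℝ)) with hd
  set X := reMat τ
  set Y := imMat τ
  have hY : IsUnit Y.det := hτ.2.det_pos.ne'.isUnit
  have hYs : Yᵀ = Y := isSymm_imMat hτ.1
  have hcd : c * dᵀ = d * cᵀ := toComplex_injective <| by
    have h := (symplectic_relations' hγ).2.1
    rw [toComplex_mul, toComplex_mul]
    convert h using 2 <;> ext <;> simp [toComplex_apply, hc, hd]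
  have hXs : Xᵀ = X := by ext i j; simp [X, reMat, hτ.1.apply]
  have key : (imMat (smulSiegel γ τ))⁻¹ = c * Y * cᵀ + (c * X + d) * Y⁻¹ * (c * X + d)ᵀ := by
    apply toComplex_injective
    have hD : denom γ τ = toComplex (c * X + d) + Complex.I • toComplex (c * Y) := by
      have h1 : γ.toBlocks₂₁.map (fun x : ℤ => (x : ℂ)) = toComplex c := by ext; simp [toComplex_apply, hc]
      have h2 : γ.toBlocks₂₂.map (fun x : ℤ => (x : ℂ)) = toComplex d := by ext; simp [toComplex_apply, hd]
      rw [denom, h1, h2]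
      nth_rewrite 1 [eq_reMat_add_imMat τ]
      rw [toComplex_add, toComplex_mul, toComplex_mul, Matrix.mul_add, Matrix.mul_smul]
      abel
    have hDc : (denom γ τ)ᴴ = toComplex (c * X + d)ᵀ - Complex.I • toComplex (c * Y)ᵀ := by
      rw [hD, conjTranspose_add, conjTranspose_smul, toComplex_conjTranspose,
        toComplex_conjTranspose, Complex.star_def, Complex.conj_I, neg_smul, sub_eq_add_neg]
    have e1 : c * Y * Y⁻¹ * (c * X + d)ᵀ = (c * X + d) * Y⁻¹ * (c * Y)ᵀ := by
      rw [Matrix.mul_assoc c, mul_nonsing_inv _ hY, mul_one, transpose_mul c Y, hYs,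
        Matrix.mul_assoc _ Y⁻¹, ← Matrix.mul_assoc Y⁻¹, nonsing_inv_mul _ hY, one_mul,
        transpose_add, transpose_mul, Matrix.mul_add, Matrix.add_mul, hcd, hXs, Matrix.mul_assoc]
    have e2 : c * Y * Y⁻¹ * (c * Y)ᵀ = c * Y * cᵀ := by
      rw [Matrix.mul_assoc c, mul_nonsing_inv _ hY, mul_one, transpose_mul c Y, hYs,
        Matrix.mul_assoc]
    rw [imMat_smulSiegel_inv hγ hτ, hDc, hD, toComplex_add (c * Y * cᵀ), ← e2]
    have e1' := congrArg toComplex e1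
    simp only [toComplex_mul _ Y⁻¹, toComplex_mul (_ * Y⁻¹)] at e1' ⊢
    simp only [Matrix.mul_sub, Matrix.add_mul, Matrix.smul_mul, Matrix.mul_smul, smul_add,
      smul_smul, Complex.I_mul_I]
    linear_combination (norm := module) Complex.I • e1'
  have hrow : intQuad (siegelForm τ) (γ (.inr i)) =
      (γ.map (fun x : ℤ => (x : ℝ)) * siegelForm τ * (γ.map (fun x : ℤ => (x : ℝ)))ᵀ)
        (.inr i) (.inr i) := by
    rw [← intQuad_one (_ * _ * _), ← intQuad_mul, one_mul]
  have hblock : γ.map (fun x : ℤ => (x : ℝ)) =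
      fromBlocks (γ.toBlocks₁₁.map (fun x : ℤ => (x : ℝ)))
        (γ.toBlocks₁₂.map (fun x : ℤ => (x : ℝ))) c d := by
    rw [← fromBlocks_map, fromBlocks_toBlocks]
  have hform : siegelForm τ = fromBlocks 1 X 0 1 * fromBlocks Y 0 0 Y⁻¹ *
      (fromBlocks 1 X 0 1)ᵀ := rfl
  rw [hrow, key, hform, hblock]
  simp only [fromBlocks_multiply, fromBlocks_transpose, fromBlocks_apply₂₂]
  refine congrFun (congrFun ?_ i) i
  simp only [transpose_one, transpose_zero, transpose_add, transpose_mul, hXs, Matrix.mul_one,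
    Matrix.mul_zero, add_zero, zero_add, Matrix.zero_mul, Matrix.one_mul]
  noncomm_ring

/-- Every orbit of the integral symplectic group meets the region `Im τ ≥ c`. -/
theorem exists_smulSiegel_imMat_ge (hn : 1 ≤ n) : ∃ c : ℝ, 0 < c ∧
    ∀ τ ∈ siegelUpperHalf (Fin n), ∃ γ ∈ symplecticGroup (Fin n) ℤ,
      (imMat (smulSiegel γ τ) - c • 1).PosSemidef := by
  obtain ⟨C, hC, hred⟩ := hasSymplecticReduction_fin hn
  have hn' : (0 : ℝ) < n := by exact_mod_cast hn
  refine ⟨(n * C)⁻¹, by positivity, fun τ hτ => ?_⟩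
  obtain ⟨γ, hγ, hb⟩ := hred _ (siegelForm_mem hτ) (siegelForm_posDef hτ)
  refine ⟨γ, hγ, ?_⟩
  have hmem := smulSiegel_mem hγ hτ
  refine posSemidef_sub_smul_one (isSymm_imMat hmem.1) fun x => ?_
  have h1 := dotProduct_self_le_quadForm hmem.2 x
  have h2 : (imMat (smulSiegel γ τ))⁻¹.trace ≤ n * C := by
    calc _ ≤ ∑ _i : Fin n, C :=
          Finset.sum_le_sum fun i _ => (imMat_smulSiegel_inv_apply hγ hτ i).trans_le (hb i)
      _ = n * C := by simp
  have h3 : 0 ≤ x ⬝ᵥ (imMat (smulSiegel γ τ) *ᵥ x) := by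
    simpa using hmem.2.posSemidef.dotProduct_mulVec_nonneg x
  rw [inv_mul_le_iff₀ (by positivity)]
  exact h1.trans (mul_le_mul_of_nonneg_right h2 h3)

end SiegelReduction

end FJ

namespace FJ

open Matrix

section InvariantNorm

variable {n : ℕ}

lemma norm_e (x : ℂ) : ‖e x‖ = Real.exp (-(2 * Real.pi * x.im)) := by
  rw [e, Complex.norm_exp]
  congr 1
  simp [Complex.mul_re, Complex.mul_im]

lemma e_add (x y : ℂ) : e (x + y) = e x * e y := by
  rw [e, e, e, ← Complex.exp_add]; ring_nf

/-- A real vector, regarded as a complex vector. -/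
def realC {ι : Type*} (v : ι → ℝ) : ι → ℂ := fun i => (v i : ℂ)

lemma realC_add {ι : Type*} (u v : ι → ℝ) : realC (u + v) = realC u + realC v := by
  ext; simp [realC]

/-- The point of `ℂⁿ` with real coordinates `(x, y)` with respect to the lattice `τ ℤⁿ + ℤⁿ`. -/
def latticePoint (τ : Matrix (Fin n) (Fin n) ℂ) (x y : Fin n → ℝ) : Fin n → ℂ :=
  τ *ᵥ realC x + realC y

lemma im_dotProduct_mulVec (τ : Matrix (Fin n) (Fin n) ℂ) (u v : Fin n → ℝ) :
    (realC u ⬝ᵥ (τ *ᵥ realC v)).im = u ⬝ᵥ (imMat τ *ᵥ v) := by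
  simp [dotProduct, mulVec, realC, imMat, Complex.im_sum]

lemma im_dotProduct_latticePoint (τ : Matrix (Fin n) (Fin n) ℂ) (u x y : Fin n → ℝ) :
    (realC u ⬝ᵥ latticePoint τ x y).im = u ⬝ᵥ (imMat τ *ᵥ x) := by
  rw [latticePoint, dotProduct_add, Complex.add_im, im_dotProduct_mulVec]
  simp [dotProduct, realC, Complex.im_sum]

/-- The invariant norm `|φ(τ, τ x + y)| e^{-2πm xᵀ (Im τ) x} det(Im τ)^{k/2}`, `k = κ / 2`,
of a Jacobi form of index `m`. -/
noncomputable def jacNorm (κ : ℤ) (m : ℕ) (φ : Matrix (Fin n) (Fin n) ℂ → (Fin n → ℂ) → ℂ)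
    (τ : Matrix (Fin n) (Fin n) ℂ) (x y : Fin n → ℝ) : ℝ :=
  ‖φ τ (latticePoint τ x y)‖ * Real.exp (-(2 * Real.pi * (m * (x ⬝ᵥ (imMat τ *ᵥ x))))) *
    (imMat τ).det ^ ((κ : ℝ) / 4)

lemma jacNorm_add_int {κ : ℤ} {m : ℕ} {φ : Matrix (Fin n) (Fin n) ℂ → (Fin n → ℂ) → ℂ}
    (hφ : IsJacobiForm n κ m φ) {τ : Matrix (Fin n) (Fin n) ℂ} (hτ : τ ∈ siegelUpperHalf (Fin n))
    (x y : Fin n → ℝ) (l μ : Fin n → ℤ) :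
    jacNorm κ m φ τ (x + fun i => (l i : ℝ)) (y + fun i => (μ i : ℝ)) = jacNorm κ m φ τ x y := by
  have hl (l : Fin n → ℤ) : (fun i => (l i : ℂ)) = realC fun i => (l i : ℝ) := by
    ext; simp [realC]
  have h := hφ.heisenberg l μ τ hτ (latticePoint τ x y)
  rw [hl, hl] at h
  set L : Fin n → ℝ := fun i => (l i : ℝ)
  set M : Fin n → ℝ := fun i => (μ i : ℝ)
  have h1 : latticePoint τ x y + τ *ᵥ realC L + realC M = latticePoint τ (x + L) (y + M) := by
    simp only [latticePoint, realC_add, mulVec_add]; abel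
  have hs : x ⬝ᵥ (imMat τ *ᵥ L) = L ⬝ᵥ (imMat τ *ᵥ x) := by
    rw [dotProduct_mulVec, ← mulVec_transpose, (isSymm_imMat hτ.1).eq, dotProduct_comm]
  have h2 : (-((m : ℂ) * (realC L ⬝ᵥ (τ *ᵥ realC L) + 2 * (realC L ⬝ᵥ latticePoint τ x y)))).im =
      -(m * (L ⬝ᵥ (imMat τ *ᵥ L) + 2 * (L ⬝ᵥ (imMat τ *ᵥ x)))) := by
    rw [Complex.neg_im, ← Complex.ofReal_natCast, Complex.im_ofReal_mul, Complex.add_im,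
      im_dotProduct_mulVec, show (2 : ℂ) = ((2 : ℝ) : ℂ) by simp, Complex.im_ofReal_mul,
      im_dotProduct_latticePoint]
  rw [jacNorm, jacNorm, ← h1, h, norm_mul, norm_e, h2, mul_right_comm (Real.exp _),
    ← Real.exp_add, mul_comm (Real.exp _)]
  congr 3
  simp only [mulVec_add, dotProduct_add, add_dotProduct, hs]
  ring

variable {γ : Matrix (Fin n ⊕ Fin n) (Fin n ⊕ Fin n) ℤ}

/-- Entrywise cast of an integral matrix to a real one. -/
abbrev intR {ι κ : Type*} (A : Matrix ι κ ℤ) : Matrix ι κ ℝ := A.map (fun x : ℤ => (x : ℝ))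

lemma realC_intR_mulVec (A : Matrix (Fin n) (Fin n) ℤ) (x : Fin n → ℝ) :
    realC ((intR A)ᵀ *ᵥ x) = (intC A)ᵀ *ᵥ realC x := by
  ext i; simp [realC, mulVec, dotProduct]

/-- The invariant norm is invariant under the integral symplectic group. -/
lemma jacNorm_smulSiegel {κ : ℤ} {m : ℕ} {φ : Matrix (Fin n) (Fin n) ℂ → (Fin n → ℂ) → ℂ}
    (hφ : IsJacobiForm n κ m φ) (hγ : γ ∈ symplecticGroup (Fin n) ℤ)
    {τ : Matrix (Fin n) (Fin n) ℂ} (hτ : τ ∈ siegelUpperHalf (Fin n)) (x y : Fin n → ℝ) :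
    jacNorm κ m φ (smulSiegel γ τ) x y = jacNorm κ m φ τ
      ((intR γ.toBlocks₁₁)ᵀ *ᵥ x + (intR γ.toBlocks₂₁)ᵀ *ᵥ y)
      ((intR γ.toBlocks₁₂)ᵀ *ᵥ x + (intR γ.toBlocks₂₂)ᵀ *ᵥ y) := by
  set x' := (intR γ.toBlocks₁₁)ᵀ *ᵥ x + (intR γ.toBlocks₂₁)ᵀ *ᵥ y with hx'
  set y' := (intR γ.toBlocks₁₂)ᵀ *ᵥ x + (intR γ.toBlocks₂₂)ᵀ *ᵥ y with hy'
  have hD := isUnit_det_denom hγ hτ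
  have hDt : IsUnit (denom γ τ)ᵀ.det := by rwa [det_transpose]
  set z := latticePoint τ x' y' with hz
  set z' := latticePoint (smulSiegel γ τ) x y with hz'
  have hDtau : (denom γ τ)ᵀ * smulSiegel γ τ = (num γ τ)ᵀ := by
    rw [smulSiegel, ← Matrix.mul_assoc, ← num_transpose_mul_denom hγ hτ.1, Matrix.mul_assoc,
      mul_nonsing_inv _ hD, Matrix.mul_one]
  have hzz : z = (denom γ τ)ᵀ *ᵥ z' := by
    rw [hz, hz', latticePoint, latticePoint, mulVec_add, mulVec_mulVec, hDtau, hx', hy', realC_add,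
      realC_add]
    simp only [realC_intR_mulVec, num, denom, transpose_add, transpose_mul, hτ.1.eq, mulVec_add,
      add_mulVec, ← mulVec_mulVec]
    abel
  have hzz' : (denom γ τ)⁻¹ᵀ *ᵥ z = z' := by
    rw [hzz, mulVec_mulVec, transpose_nonsing_inv, nonsing_inv_mul _ hDt, one_mulVec]
  obtain ⟨w, hw⟩ := IsAlgClosed.exists_pow_nat_eq (denom γ τ).det two_pos
  have h := hφ.symplectic γ hγ τ hτ z w hw
  rw [hzz'] at h
  change φ (smulSiegel γ τ) z' = _ at h
  obtain ⟨-, r1, r2⟩ := symplectic_relations' hγ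
  have hcD : intC γ.toBlocks₂₁ * (denom γ τ)ᵀ = denom γ τ * (intC γ.toBlocks₂₁)ᵀ := by
    simp only [denom, transpose_add, transpose_mul, hτ.1.eq, Matrix.mul_add, Matrix.add_mul,
      Matrix.mul_assoc]
    rw [r1]
  have hmat : 1 + smulSiegel γ τ * (intC γ.toBlocks₂₁ * (denom γ τ)ᵀ) =
      intC γ.toBlocks₁₁ * (denom γ τ)ᵀ := by
    rw [hcD, smulSiegel, Matrix.mul_assoc, ← Matrix.mul_assoc _ (denom γ τ),
      nonsing_inv_mul _ hD, Matrix.one_mul, ← r2]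
    simp only [num, denom, transpose_add, transpose_mul, hτ.1.eq, Matrix.mul_add, Matrix.add_mul,
      Matrix.mul_assoc]
    abel
  have hkey : realC x ⬝ᵥ z' +
      z ⬝ᵥ (((denom γ τ)⁻¹ * γ.toBlocks₂₁.map (fun x : ℤ => (x : ℂ))) *ᵥ z) = realC x' ⬝ᵥ z := by
    have e1 : z ⬝ᵥ (((denom γ τ)⁻¹ * intC γ.toBlocks₂₁) *ᵥ z) =
        z' ⬝ᵥ (intC γ.toBlocks₂₁ *ᵥ z) := by
      nth_rewrite 1 [hzz]
      rw [mulVec_transpose, ← dotProduct_mulVec, mulVec_mulVec, ← Matrix.mul_assoc,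
        mul_nonsing_inv _ hD, Matrix.one_mul]
    have e2 : z' ⬝ᵥ (intC γ.toBlocks₂₁ *ᵥ z) =
        realC x ⬝ᵥ ((smulSiegel γ τ * (intC γ.toBlocks₂₁ * (denom γ τ)ᵀ)) *ᵥ z') +
          realC y ⬝ᵥ (intC γ.toBlocks₂₁ *ᵥ z) := by
      nth_rewrite 1 [hz']
      rw [latticePoint, add_dotProduct, ← vecMul_transpose, (smulSiegel_isSymm hγ hτ).eq,
        ← dotProduct_mulVec, ← mulVec_mulVec, ← mulVec_mulVec, ← hzz]
    have e3 : realC x' ⬝ᵥ z = realC x ⬝ᵥ ((intC γ.toBlocks₁₁ * (denom γ τ)ᵀ) *ᵥ z') +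
        realC y ⬝ᵥ (intC γ.toBlocks₂₁ *ᵥ z) := by
      rw [hx', realC_add, realC_intR_mulVec, realC_intR_mulVec, add_dotProduct, mulVec_transpose,
        mulVec_transpose, ← dotProduct_mulVec, ← dotProduct_mulVec, ← mulVec_mulVec, ← hzz]
    have e4 := congrArg (fun A => realC x ⬝ᵥ (A *ᵥ z')) hmat
    simp only [add_mulVec, one_mulVec, dotProduct_add] at e4
    change realC x ⬝ᵥ z' + z ⬝ᵥ (((denom γ τ)⁻¹ * intC γ.toBlocks₂₁) *ᵥ z) = _
    rw [e1, e2, e3, ← add_assoc, e4]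
  have him := congrArg Complex.im hkey
  rw [Complex.add_im, hz', hz, im_dotProduct_latticePoint, im_dotProduct_latticePoint, ← hz] at him
  have hw0 : 0 < ‖w‖ := norm_pos_iff.mpr fun h0 => hD.ne_zero <| by rw [← hw, h0]; simp
  have hdet : (imMat (smulSiegel γ τ)).det ^ ((κ : ℝ) / 4) * ‖w‖ ^ κ =
      (imMat τ).det ^ ((κ : ℝ) / 4) := by
    rw [det_imMat_smulSiegel hγ hτ, ← hw, norm_pow, ← pow_mul,
      Real.div_rpow hτ.2.det_pos.le (by positivity), ← Real.rpow_natCast, ← Real.rpow_mul hw0.le,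
      ← Real.rpow_intCast]
    rw [show ((2 * 2 : ℕ) : ℝ) * ((κ : ℝ) / 4) = κ by push_cast; ring,
      div_mul_cancel₀ _ (Real.rpow_pos_of_pos hw0 _).ne']
  rw [jacNorm, jacNorm, ← hz, ← hz', h, norm_mul, norm_mul, norm_zpow, norm_e,
    ← Complex.ofReal_natCast, Complex.im_ofReal_mul, ← hdet, ← him, mul_add, mul_add, neg_add,
    Real.exp_add]
  ring

end InvariantNorm

end FJ

namespace FJ

open Matrix MeasureTheory

section FourierCoefficients

lemma e_zero : e 0 = 1 := by simp [e]

lemma e_sum {ι : Type*} (s : Finset ι) (f : ι → ℂ) : e (∑ i ∈ s, f i) = ∏ i ∈ s, e (f i) := by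
  classical
  induction s using Finset.induction_on with
  | empty => simp [e_zero]
  | insert i s hi ih => rw [Finset.sum_insert hi, Finset.prod_insert hi, e_add, ih]

lemma norm_e_ofReal (x : ℝ) : ‖e (x : ℂ)‖ = 1 := by simp [norm_e]

lemma continuous_e : Continuous e := by unfold e; fun_prop

lemma integral_e_int_mul (k : ℤ) :
    ∫ x : ℝ in Set.Ioc 0 1, e ((k : ℂ) * x) = if k = 0 then 1 else 0 := by
  rw [← intervalIntegral.integral_of_le zero_le_one]
  split_ifs with hk
  · simp [hk, e_zero]
  · have hc : 2 * Real.pi * Complex.I * (k : ℂ) ≠ 0 := by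
      simp [hk, Real.pi_ne_zero]
    have h1 (x : ℝ) : e ((k : ℂ) * x) = Complex.exp (2 * Real.pi * Complex.I * k * x) := by
      rw [e, mul_assoc (2 * Real.pi * Complex.I)]
    simp only [h1]
    rw [integral_exp_mul_complex hc]
    have h2 : Complex.exp (2 * Real.pi * Complex.I * k * (1 : ℝ)) = 1 := by
      rw [Complex.exp_eq_one_iff]
      exact ⟨k, by push_cast; ring⟩
    rw [h2]; simp

/-- The Fourier coefficients of an absolutely convergent trigonometric series are bounded by
its supremum. -/
lemma norm_tsum_fiber_le {P D : Type*} [Countable P] [Fintype D] {c : P → ℂ}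
    (hc : Summable fun p => ‖c p‖) (ν : P → D → ℤ) {F : ℝ}
    (hF : ∀ x : D → ℝ, ‖∑' p, c p * e (∑ d, (ν p d : ℂ) * x d)‖ ≤ F) (ν₀ : D → ℤ) :
    ‖∑' p : {p // ν p = ν₀}, c p‖ ≤ F := by
  classical
  let μ : Measure (D → ℝ) := Measure.pi fun _ => volume.restrict (Set.Ioc (0 : ℝ) 1)
  have : IsProbabilityMeasure (volume.restrict (Set.Ioc (0 : ℝ) 1)) :=
    ⟨by simp⟩
  have hμ : IsProbabilityMeasure μ := by infer_instance
  let f (p : P) (x : D → ℝ) : ℂ := c p * e (∑ d, ((ν p d - ν₀ d : ℤ) : ℂ) * x d)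
  have hnorm (p : P) (x : D → ℝ) : ‖f p x‖ = ‖c p‖ := by
    have : (∑ d, ((ν p d - ν₀ d : ℤ) : ℂ) * x d) =
        ((∑ d, ((ν p d - ν₀ d : ℤ) : ℝ) * x d : ℝ) : ℂ) := by push_cast; rfl
    simp only [f]
    rw [norm_mul, this, norm_e_ofReal, mul_one]
  have hcont (p : P) : Continuous (f p) :=
    continuous_const.mul (continuous_e.comp (by fun_prop))
  have hInt (p : P) : Integrable (f p) μ :=
    Integrable.of_bound (hcont p).aestronglyMeasurable ‖c p‖
      (ae_of_all _ fun x => (hnorm p x).le)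
  have h1 := integral_tsum_of_summable_integral_norm hInt (by simpa [hnorm] using hc)
  have h2 (p : P) : ∫ x, f p x ∂μ = if ν p = ν₀ then c p else 0 := by
    simp only [f, e_sum]
    rw [integral_const_mul]
    rw [show ∫ x : D → ℝ, ∏ d, e (((ν p d - ν₀ d : ℤ) : ℂ) * x d) ∂μ =
      ∏ d, ∫ y : ℝ in Set.Ioc 0 1, e (((ν p d - ν₀ d : ℤ) : ℂ) * y) from
      integral_fintype_prod_eq_prod (fun d (y : ℝ) => e (((ν p d - ν₀ d : ℤ) : ℂ) * y))]
    simp only [integral_e_int_mul]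
    split_ifs with h
    · simp [h]
    · obtain ⟨d, hd⟩ := Function.ne_iff.mp h
      rw [Finset.prod_eq_zero (Finset.mem_univ d), mul_zero]
      rw [if_neg (sub_ne_zero.mpr hd)]
  have h3 : ∑' p : {p // ν p = ν₀}, c p = ∫ x, ∑' p, f p x ∂μ := by
    rw [← h1]
    simp only [h2]
    exact (tsum_subtype {p | ν p = ν₀} c).trans (tsum_congr fun p => by
      simp [Set.indicator_apply])
  have h4 (x : D → ℝ) : ‖∑' p, f p x‖ ≤ F := by
    have : (fun p => f p x) =
        fun p => e (((-∑ d, ((ν₀ d : ℝ)) * x d : ℝ)) : ℂ) * (c p * e (∑ d, (ν p d : ℂ) * x d)) := by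
      ext p
      simp only [f]
      rw [mul_left_comm, ← e_add]
      congr 2
      push_cast
      simp only [sub_mul, Finset.sum_sub_distrib]
      ring
    rw [this, tsum_mul_left, norm_mul, norm_e_ofReal, one_mul]
    exact hF x
  rw [h3]
  simpa using norm_integral_le_of_norm_le_const (μ := μ) (ae_of_all _ h4)

lemma eq_zero_of_trigonometric_series_eq_zero {P D : Type*} [Countable P] [Fintype D]
    {c : P → ℂ} (hc : Summable fun p => ‖c p‖) {ν : P → D → ℤ} (hν : Function.Injective ν)
    (hF : ∀ x : D → ℝ, ∑' p, c p * e (∑ d, (ν p d : ℂ) * x d) = 0) (p : P) : c p = 0 := by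
  have h := norm_tsum_fiber_le hc ν (F := 0) (fun x => by rw [hF x, norm_zero]) (ν p)
  have : Unique {q // ν q = ν p} := ⟨⟨⟨p, rfl⟩⟩, fun q => Subtype.ext (hν q.2)⟩
  rw [tsum_eq_single ⟨p, rfl⟩ fun q hq => (hq (Subsingleton.elim _ _)).elim] at h
  simpa using h

end FourierCoefficients

section IntegralVectors

/-- Every integral vector is a multiple of a column of a unimodular matrix. -/
lemma exists_GL_col {ι : Type*} [Fintype ι] [DecidableEq ι] (v : ι → ℤ) (j : ι) :
    ∃ (u : GL ι ℤ) (d : ℤ), ∀ i, v i = d * u.1 i j := by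
  by_cases hv : v = 0
  · exact ⟨1, 0, by simp [hv]⟩
  obtain ⟨k, S⟩ := Submodule.smithNormalForm (Pi.basisFun ℤ ι) (Submodule.span ℤ {v})
  have hk : Nonempty (Fin k) := by
    by_contra hk
    rw [not_nonempty_iff] at hk
    have : (⟨v, Submodule.mem_span_singleton_self v⟩ : Submodule.span ℤ {v}) = 0 :=
      S.bN.ext_elem fun i => hk.elim i
    exact hv (congrArg Subtype.val this)
  have hsub : Subsingleton (Fin k) := by
    have h1 : k ≤ 1 := by
      have := Module.finrank_eq_card_basis S.bN
      have h2 := finrank_span_le_card (R := ℤ) {v}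
      rw [this] at h2
      simpa using h2
    exact Fin.subsingleton_iff_le_one.mpr h1
  obtain ⟨i₀⟩ := hk
  have : Unique (Fin k) := ⟨⟨i₀⟩, fun a => Subsingleton.elim _ _⟩
  obtain ⟨d, hd⟩ : ∃ d : ℤ, v = d • S.bM (S.f i₀) := by
    have h1 := S.bN.sum_repr ⟨v, Submodule.mem_span_singleton_self v⟩
    have h2 := congrArg Subtype.val h1
    rw [Fintype.sum_unique, Submodule.coe_smul, S.snf, smul_smul,
      Subsingleton.elim default i₀] at h2
    exact ⟨_, h2.symm⟩
  let b := S.bM.reindex (Equiv.swap (S.f i₀) j)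
  let M : Matrix ι ι ℤ := (Pi.basisFun ℤ ι).toMatrix b
  have hM : M * b.toMatrix (Pi.basisFun ℤ ι) = 1 := Module.Basis.toMatrix_mul_toMatrix_flip _ _
  have hM' : b.toMatrix (Pi.basisFun ℤ ι) * M = 1 := Module.Basis.toMatrix_mul_toMatrix_flip _ _
  refine ⟨⟨M, _, hM, hM'⟩, d, fun i => ?_⟩
  rw [hd]
  simp [M, Module.Basis.toMatrix_apply, b]

end IntegralVectors

end FJ

namespace FJ

open Matrix MeasureTheory

section HalfIntegral

/-- A rational matrix, regarded as a real matrix. -/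
abbrev ratR {ι κ : Type*} (t : Matrix ι κ ℚ) : Matrix ι κ ℝ := t.map (fun x : ℚ => (x : ℝ))

/-- Entrywise cast of an integral matrix to a rational one. -/
abbrev intQ {ι κ : Type*} (u : Matrix ι κ ℤ) : Matrix ι κ ℚ := u.map (fun x : ℤ => (x : ℚ))

variable {ι : Type*} [Fintype ι]

lemma even_quadForm {T : Matrix ι ι ℤ} (hT : T.IsSymm) (hd : ∀ i, Even (T i i)) (x : ι → ℤ) :
    Even (x ⬝ᵥ (T *ᵥ x)) := by
  classical
  rw [← ZMod.intCast_eq_zero_iff_even]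
  have h1 : ((x ⬝ᵥ (T *ᵥ x) : ℤ) : ZMod 2) =
      ∑ p : ι × ι, ((x p.1 * (T p.1 p.2 * x p.2) : ℤ) : ZMod 2) := by
    rw [← Int.cast_sum, Fintype.sum_prod_type]
    simp [dotProduct, mulVec, Finset.mul_sum]
  rw [h1]
  refine Finset.sum_involution (fun p _ => p.swap) (fun p _ => ?_) (fun p _ hp heq => hp ?_)
    (fun _ _ => Finset.mem_univ _) (fun p _ => Prod.swap_swap p)
  · have h2 : x p.swap.1 * (T p.swap.1 p.swap.2 * x p.swap.2) = x p.1 * (T p.1 p.2 * x p.2) := by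
      simp only [Prod.fst_swap, Prod.snd_swap, hT.apply]; ring
    rw [h2]
    exact CharTwo.add_self_eq_zero _
  · have h2 : p.2 = p.1 := congrArg Prod.fst heq
    rw [ZMod.intCast_eq_zero_iff_even, h2]
    exact ((hd p.1).mul_right _).mul_left _

lemma IsHalfIntegral.exists_int {ι : Type*} {t : Matrix ι ι ℚ} (ht : IsHalfIntegral t) :
    ∃ T : Matrix ι ι ℤ, intQ T = (2 : ℚ) • t ∧ T.IsSymm ∧ ∀ i, Even (T i i) := by
  choose T hT using ht.2.2
  refine ⟨of T, by ext; simp [hT], ?_, fun i => ?_⟩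
  · ext i j
    have : ((T j i : ℤ) : ℚ) = T i j := by rw [← hT, ← hT, ht.1.apply]
    exact_mod_cast this
  · obtain ⟨a, ha⟩ := ht.2.1 i
    refine ⟨a, ?_⟩
    have : ((T i i : ℤ) : ℚ) = a + a := by rw [← hT, ha]; ring
    exact_mod_cast this

lemma intQ_mul {κ ν : Type*} (A : Matrix ν ι ℤ) (B : Matrix ι κ ℤ) :
    intQ (A * B) = intQ A * intQ B :=
  Matrix.map_mul (L := A) (M := B) (f := Int.castRingHom ℚ)

lemma IsHalfIntegral.conj {t : Matrix ι ι ℚ} (ht : IsHalfIntegral t) (u : Matrix ι ι ℤ) :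
    IsHalfIntegral ((intQ u)ᵀ * t * intQ u) := by
  obtain ⟨T, hT, hs, hd⟩ := ht.exists_int
  have h1 : (2 : ℚ) • ((intQ u)ᵀ * t * intQ u) = intQ (uᵀ * T * u) := by
    rw [intQ_mul, intQ_mul, hT, Matrix.mul_smul, Matrix.smul_mul]; rfl
  have h2 (i j : ι) : 2 * ((intQ u)ᵀ * t * intQ u) i j = ((uᵀ * T * u) i j : ℤ) :=
    congrFun (congrFun h1 i) j
  refine ⟨?_, fun i => ?_, fun i j => ⟨_, h2 i j⟩⟩
  · rw [IsSymm, transpose_mul, transpose_mul, transpose_transpose, ht.1.eq, Matrix.mul_assoc]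
  · have h3 : (uᵀ * T * u) i i = (fun k => u k i) ⬝ᵥ (T *ᵥ fun k => u k i) := by
      rw [Matrix.mul_assoc, mul_apply]; rfl
    obtain ⟨a, ha⟩ := even_quadForm hs hd fun k => u k i
    refine ⟨a, ?_⟩
    have h4 := h2 i i
    rw [h3, ha] at h4
    push_cast at h4
    linarith

lemma exists_int_smul_eq (q : ι → ℚ) : ∃ (D : ℕ) (v : ι → ℤ), 0 < D ∧ ∀ i, (v i : ℚ) = D * q i := by
  classical
  refine ⟨∏ i, (q i).den, fun i => (q i).num * ∏ j ∈ Finset.univ.erase i, ((q j).den : ℤ),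
    Finset.prod_pos fun i _ => (q i).pos, fun i => ?_⟩
  rw [← Finset.mul_prod_erase _ _ (Finset.mem_univ i)]
  push_cast
  rw [mul_right_comm, Rat.den_mul_eq_num (q i)]

lemma posDef_ratR {t : Matrix ι ι ℚ} (hs : t.IsSymm)
    (h : ∀ v : ι → ℤ, v ≠ 0 → 0 < intQuad (ratR t) v) : (ratR t).PosDef := by
  classical
  have hrat (q : ι → ℚ) (hq : q ≠ 0) : 0 < q ⬝ᵥ (t *ᵥ q) := by
    obtain ⟨D, v, hD, hv⟩ := exists_int_smul_eq q
    have hD' : (0 : ℚ) < D := by exact_mod_cast hD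
    have hv0 : v ≠ 0 := by
      rintro rfl
      refine hq (funext fun i => ?_)
      have := hv i
      simp only [Pi.zero_apply, Int.cast_zero, zero_eq_mul] at this
      exact this.resolve_left hD'.ne'
    have h1 := h v hv0
    have h2 : intQuad (ratR t) v = ((D ^ 2 * (q ⬝ᵥ (t *ᵥ q)) : ℚ) : ℝ) := by
      have hv' (i : ι) : (v i : ℝ) = ((D * q i : ℚ) : ℝ) := by rw [← hv]; simp
      simp only [intQuad, dotProduct, mulVec, hv', map_apply]
      push_cast
      simp only [Finset.mul_sum]
      exact Finset.sum_congr rfl fun i _ => Finset.sum_congr rfl fun j _ => by ring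
    rw [h2] at h1
    have h3 : (0 : ℚ) < D ^ 2 * (q ⬝ᵥ (t *ᵥ q)) := by exact_mod_cast h1
    exact pos_of_mul_pos_right h3 (by positivity)
  have hsR : (ratR t).IsSymm := by ext i j; simp [hs.apply]
  have hpsd : (ratR t).PosSemidef := by
    refine .of_dotProduct_mulVec_nonneg
      (by rwa [IsHermitian, conjTranspose_eq_transpose_of_trivial]) fun x => ?_
    rw [star_trivial]
    have hdense : DenseRange fun (q : ι → ℚ) (i : ι) => (q i : ℝ) :=
      DenseRange.piMap fun _ => Rat.denseRange_cast
    have hcl : IsClosed {x : ι → ℝ | 0 ≤ x ⬝ᵥ (ratR t *ᵥ x)} :=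
      isClosed_le continuous_const
        (Continuous.dotProduct continuous_id (Continuous.matrix_mulVec continuous_const continuous_id))
    refine hdense.induction_on (p := fun x : ι → ℝ => 0 ≤ x ⬝ᵥ (ratR t *ᵥ x)) x hcl fun q => ?_
    have h1 : (fun i => (q i : ℝ)) ⬝ᵥ (ratR t *ᵥ fun i => (q i : ℝ)) =
        ((q ⬝ᵥ (t *ᵥ q) : ℚ) : ℝ) := by
      simp [dotProduct, mulVec]
    rw [h1]
    rcases eq_or_ne q 0 with rfl | hq
    · simp
    · exact_mod_cast (hrat q hq).le
  rw [hpsd.posDef_iff_det_ne_zero]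
  have h1 : (ratR t).det = ((t.det : ℚ) : ℝ) := (RingHom.map_det (Rat.castHom ℝ) t).symm
  rw [h1]
  intro h0
  obtain ⟨q, hq, hq0⟩ := exists_mulVec_eq_zero_iff.mpr (show t.det = 0 by exact_mod_cast h0)
  have := hrat q hq
  rw [hq0, dotProduct_zero] at this
  exact this.false

end HalfIntegral

section Support

variable {n : ℕ}

/-- The index set of the Fourier expansion of a Jacobi form. -/
abbrev FourierIndex (n : ℕ) : Type :=
  {s : Matrix (Fin n) (Fin n) ℚ // IsHalfIntegral s} × (Fin n → ℤ)

instance : Countable (FourierIndex n) := by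
  have : Countable (Matrix (Fin n) (Fin n) ℚ) := inferInstanceAs (Countable (Fin n → Fin n → ℚ))
  infer_instance

lemma isHalfIntegral_blockIndex {s : Matrix (Fin n) (Fin n) ℚ} (hs : IsHalfIntegral s)
    (r : Fin n → ℤ) (m : ℤ) : IsHalfIntegral (blockIndex s r m) := by
  refine ⟨?_, ?_, ?_⟩
  · refine IsSymm.fromBlocks hs.1 ?_ ?_ <;> ext <;> simp
  · rintro (i | i)
    · exact hs.2.1 i
    · exact ⟨m, rfl⟩
  · rintro (i | i) (j | j)
    · exact hs.2.2 i j
    · exact ⟨r i, by simp [blockIndex]; ring⟩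
    · exact ⟨r j, by simp [blockIndex]; ring⟩
    · exact ⟨2 * m, by simp [blockIndex]⟩

lemma IsHalfIntegral.exists_blockIndex {t : Matrix (Fin n ⊕ Unit) (Fin n ⊕ Unit) ℚ}
    (ht : IsHalfIntegral t) : ∃ p : FourierIndex n,
      t = blockIndex p.1.1 p.2 (t (.inr ()) (.inr ())) := by
  choose r hr using fun i : Fin n => ht.2.2 (.inl i) (.inr ())
  refine ⟨⟨⟨t.toBlocks₁₁, ?_, fun i => ht.2.1 (.inl i), fun i j => ht.2.2 (.inl i) (.inl j)⟩, r⟩, ?_⟩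
  · ext i j; exact ht.1.apply _ _
  · ext (i | i) (j | j)
    · rfl
    · simp only [blockIndex, fromBlocks_apply₁₂, of_apply, ← hr]; ring_nf
    · simp only [blockIndex, fromBlocks_apply₂₁, of_apply, ← hr, ht.1.apply (.inl j) (.inr i)]
      ring_nf
    · rfl

lemma blockIndex_injective {m m' : ℚ} {p p' : FourierIndex n}
    (h : blockIndex p.1.1 p.2 m = blockIndex p'.1.1 p'.2 m') : p = p' := by
  obtain ⟨h1, h2, -, -⟩ := fromBlocks_inj.mp h
  refine Prod.ext (Subtype.ext h1) (funext fun i => ?_)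
  have h3 := congrFun (congrFun h2 i) ()
  simp only [of_apply] at h3
  have h4 : (p.2 i : ℚ) = p'.2 i := by linarith
  exact_mod_cast h4

/-- The point `i y` of the Siegel upper half space. -/
lemma scalar_mem_siegelUpperHalf {ι : Type*} [Fintype ι] [DecidableEq ι] {X : Matrix ι ι ℝ}
    (hX : X.IsSymm) {y : ℝ} (hy : 0 < y) :
    toComplex X + (y * Complex.I) • (1 : Matrix ι ι ℂ) ∈ siegelUpperHalf ι := by
  refine ⟨?_, ?_⟩
  · refine IsSymm.add ?_ (IsSymm.smul isSymm_one _)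
    ext i j; simp [toComplex_apply, hX.apply]
  · have : imMat (toComplex X + (y * Complex.I) • (1 : Matrix ι ι ℂ)) = y • 1 := by
      ext i j
      simp [imMat, toComplex_apply, one_apply]
      split_ifs <;> simp
    rw [this]
    exact PosDef.one.smul hy

/-- The coefficients of a vanishing Fourier expansion vanish. -/
lemma HasFourierExpansion.eq_zero {φ : Matrix (Fin n) (Fin n) ℂ → (Fin n → ℂ) → ℂ}
    {c : Matrix (Fin n) (Fin n) ℚ → (Fin n → ℤ) → ℂ} (h : HasFourierExpansion φ c)
    (h0 : ∀ τ ∈ siegelUpperHalf (Fin n), ∀ z, φ τ z = 0) (p : FourierIndex n) :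
    c p.1.1 p.2 = 0 := by
  let ν (p : FourierIndex n) : (Fin n × Fin n) ⊕ Fin n → ℤ :=
    Sum.elim (fun q => (2 * p.1.1 q.1 q.2).num) p.2
  have hnum (p : FourierIndex n) (i j : Fin n) :
      (((2 * p.1.1 i j).num : ℤ) : ℚ) = 2 * p.1.1 i j := by
    obtain ⟨a, ha⟩ := p.1.2.2.2 i j
    rw [ha]; simp
  have hν : Function.Injective ν := by
    intro p q hpq
    refine Prod.ext (Subtype.ext ?_) ?_
    · ext i j
      have h1 : (2 * p.1.1 i j).num = (2 * q.1.1 i j).num := congrFun hpq (.inl (i, j))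
      have h2 := hnum p i j
      rw [h1, hnum q i j] at h2
      linarith
    · ext i; exact congrFun hpq (.inr i)
  let c' (p : FourierIndex n) : ℂ :=
    c p.1.1 p.2 * e (((1 : ℝ) * Complex.I) * (p.1.1.map (fun x : ℚ => (x : ℂ))).trace)
  have key (x : (Fin n × Fin n) ⊕ Fin n → ℝ) :
      HasSum (fun p => c' p * e (∑ d, (ν p d : ℂ) * x d)) 0 := by
    let X : Matrix (Fin n) (Fin n) ℝ := of fun i j => x (.inl (i, j)) + x (.inl (j, i))
    have hX : X.IsSymm := by ext i j; simp [X, add_comm]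
    have hmem := scalar_mem_siegelUpperHalf hX one_pos
    have h1 := h _ hmem (fun i => (x (.inr i) : ℂ))
    rw [h0 _ hmem] at h1
    convert h1 using 2 with p
    rw [mul_assoc, ← e_add]
    congr 2
    rw [Matrix.mul_add, trace_add, Matrix.mul_smul, mul_one, trace_smul, smul_eq_mul]
    have hn (i j : Fin n) : (((2 * p.1.1 i j).num : ℤ) : ℂ) = 2 * (p.1.1 i j : ℂ) := by
      exact_mod_cast congrArg (fun q : ℚ => (q : ℂ)) (hnum p i j)
    have h2 : ((p.1.1.map (fun x : ℚ => (x : ℂ))) * toComplex X).trace =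
        ∑ i, ∑ j, (p.1.1 i j : ℂ) * x (.inl (j, i)) +
          ∑ i, ∑ j, (p.1.1 i j : ℂ) * x (.inl (i, j)) := by
      simp [trace, mul_apply, toComplex_apply, X, mul_add, Finset.sum_add_distrib]
    have h3 : ∑ i, ∑ j, (p.1.1 i j : ℂ) * x (.inl (j, i)) =
        ∑ i, ∑ j, (p.1.1 i j : ℂ) * x (.inl (i, j)) := by
      rw [Finset.sum_comm]
      simp only [p.1.2.1.apply]
    have h4 : ∑ d, (ν p d : ℂ) * x d = 2 * ∑ i, ∑ j, (p.1.1 i j : ℂ) * x (.inl (i, j)) +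
        (fun i => (p.2 i : ℂ)) ⬝ᵥ fun i => (x (.inr i) : ℂ) := by
      simp [ν, Fintype.sum_sum_type, Fintype.sum_prod_type, hn, dotProduct, Finset.mul_sum,
        mul_assoc]
    rw [h2, h3, h4]; ring
  have hsum : Summable fun p => ‖c' p‖ := by
    have := (key 0).summable.norm
    simpa [e_zero] using this
  have := eq_zero_of_trigonometric_series_eq_zero hsum hν (fun x => (key x).tsum_eq) p
  exact (mul_eq_zero.mp this).resolve_right (by simp [e, Complex.exp_ne_zero])

variable {κ : ℤ} {φ : ℕ → Matrix (Fin n) (Fin n) ℂ → (Fin n → ℂ) → ℂ}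

/-- The symmetry of the Fourier coefficients, up to absolute value. -/
def IsNormSymmetric (a : Matrix (Fin n ⊕ Unit) (Fin n ⊕ Unit) ℚ → ℂ) : Prop :=
  ∀ (u : GL (Fin n ⊕ Unit) ℤ) (t : Matrix (Fin n ⊕ Unit) (Fin n ⊕ Unit) ℚ), IsHalfIntegral t →
    ‖a ((intQ u.1)ᵀ * t * intQ u.1)‖ = ‖a t‖

lemma IsSymmetricFJ.exists_coeff (hf : IsSymmetricFJ n κ φ) :
    ∃ a, IsCoeffFamily φ a ∧ IsNormSymmetric (n := n) a := by
  obtain ⟨a, ha, hsym⟩ := hf.symmetric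
  refine ⟨a, ha, fun u t ht => ?_⟩
  obtain ⟨w, hw⟩ := IsAlgClosed.exists_pow_nat_eq
    ((u : Matrix (Fin n ⊕ Unit) (Fin n ⊕ Unit) ℤ).det : ℂ) two_pos
  have hu : IsUnit (u : Matrix (Fin n ⊕ Unit) (Fin n ⊕ Unit) ℤ).det :=
    (isUnit_iff_isUnit_det _).mp u.isUnit
  have hw1 : ‖w‖ = 1 := by
    have h1 : ‖w‖ ^ 2 = 1 := by
      rw [← norm_pow, hw]
      rcases Int.isUnit_iff.mp hu with h | h <;> simp [h]
    exact (pow_eq_one_iff_of_nonneg (norm_nonneg _) two_ne_zero).mp h1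
  rw [hsym u w hw t ht, norm_mul, norm_zpow, hw1, _root_.one_zpow, one_mul]

/-- The Fourier coefficients of a cuspidal symmetric formal Fourier-Jacobi series are supported
on positive definite matrices. -/
lemma posDef_of_coeff_ne_zero {a : Matrix (Fin n ⊕ Unit) (Fin n ⊕ Unit) ℚ → ℂ}
    (ha : IsCoeffFamily φ a) (hsym : IsNormSymmetric a) (hcusp : IsCuspidal φ)
    {t : Matrix (Fin n ⊕ Unit) (Fin n ⊕ Unit) ℚ} (ht : IsHalfIntegral t) (h0 : a t ≠ 0) :
    (ratR t).PosDef := by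
  refine posDef_ratR ht.1 fun v hv => ?_
  obtain ⟨u, d, hu⟩ := exists_GL_col v (.inr ())
  have hd : d ≠ 0 := by
    rintro rfl
    exact hv (funext fun i => by simpa using hu i)
  set t' := (intQ u.1)ᵀ * t * intQ u.1 with ht'
  have hth : IsHalfIntegral t' := ht.conj u.1
  have ha' : a t' ≠ 0 := by rw [← norm_ne_zero_iff, hsym u t ht, norm_ne_zero_iff]; exact h0
  have hlast : 0 < t' (.inr ()) (.inr ()) := by
    by_contra hle
    rcases (not_lt.mp hle).lt_or_eq with hlt | heq
    · exact ha' (ha.2 t' hth hlt)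
    · obtain ⟨p, hp⟩ := hth.exists_blockIndex
      have h1 := (ha.1 0).eq_zero hcusp p
      rw [heq] at hp
      rw [hp] at ha'
      exact ha' (by simpa using h1)
  have h2 : intQuad (ratR t) v = d ^ 2 * ((t' (.inr ()) (.inr ()) : ℚ) : ℝ) := by
    have hvi (i) : (v i : ℝ) = d * (u.1 i (.inr ()) : ℝ) := by rw [hu i]; push_cast; rfl
    rw [ht', Matrix.mul_assoc, mul_apply]
    simp only [intQuad, dotProduct, mulVec, mul_apply, transpose_apply, map_apply, hvi]
    push_cast
    simp only [Finset.mul_sum]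
    exact Finset.sum_congr rfl fun i _ => Finset.sum_congr rfl fun j _ => by ring
  rw [h2]
  have h3 : (0 : ℝ) < ((t' (.inr ()) (.inr ()) : ℚ) : ℝ) := by exact_mod_cast hlast
  positivity

end Support

end FJ

namespace FJ

open Matrix

section Twist

variable {n : ℕ}

/-- The matrix `(1, x)` of the substitution `z = τ x`. -/
def twistCols (x : Fin n → ℝ) : Matrix (Fin n ⊕ Unit) (Fin n) ℝ := fromRows 1 (of fun _ j => x j)

/-- The index `(1, x) t (1, x)ᵀ` in the Fourier expansion at `z = τ x + y`. -/
noncomputable def twist (x : Fin n → ℝ) (t : Matrix (Fin n ⊕ Unit) (Fin n ⊕ Unit) ℚ) :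
    Matrix (Fin n) (Fin n) ℝ :=
  (twistCols x)ᵀ * ratR t * twistCols x

lemma twist_blockIndex_apply (x : Fin n → ℝ) (s : Matrix (Fin n) (Fin n) ℚ) (r : Fin n → ℤ)
    (m : ℚ) (i j : Fin n) : twist x (blockIndex s r m) i j =
      s i j + (x i * r j + r i * x j) / 2 + m * (x i * x j) := by
  simp [twist, twistCols, blockIndex, mul_apply, Fintype.sum_sum_type, one_apply, add_mul,
    Finset.sum_add_distrib]
  ring

lemma twist_posDef (x : Fin n → ℝ) {t : Matrix (Fin n ⊕ Unit) (Fin n ⊕ Unit) ℚ}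
    (ht : (ratR t).PosDef) : (twist x t).PosDef := by
  have := ht.conjTranspose_mul_mul_same (B := twistCols x) fun v w h => by
    ext i
    simpa [twistCols, mulVec, dotProduct, one_apply] using congrFun h (.inl i)
  rwa [conjTranspose_eq_transpose_of_trivial] at this

lemma trace_toComplex_mul_im (S : Matrix (Fin n) (Fin n) ℝ) (τ : Matrix (Fin n) (Fin n) ℂ) :
    (toComplex S * τ).trace.im = (S * imMat τ).trace := by
  simp [trace, mul_apply, toComplex_apply, imMat, Complex.im_sum]

lemma trace_twist_mul (x : Fin n → ℝ) (s : Matrix (Fin n) (Fin n) ℚ) (r : Fin n → ℤ) (m : ℕ)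
    {τ : Matrix (Fin n) (Fin n) ℂ} (hτ : τ.IsSymm) :
    (toComplex (twist x (blockIndex s r m)) * τ).trace =
      (s.map (fun x : ℚ => (x : ℂ)) * τ).trace + (fun i => (r i : ℂ)) ⬝ᵥ (τ *ᵥ realC x) +
        m * (realC x ⬝ᵥ (τ *ᵥ realC x)) := by
  have h1 : (fun i => (r i : ℂ)) ⬝ᵥ (τ *ᵥ realC x) = ∑ i, ∑ j, (x i * r j : ℂ) * τ j i := by
    simp only [dotProduct, mulVec, Finset.mul_sum, realC]
    rw [Finset.sum_comm]
    exact Finset.sum_congr rfl fun i _ => Finset.sum_congr rfl fun j _ => by ring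
  have h2 : (fun i => (r i : ℂ)) ⬝ᵥ (τ *ᵥ realC x) = ∑ i, ∑ j, (r i * x j : ℂ) * τ j i := by
    simp only [dotProduct, mulVec, Finset.mul_sum, realC]
    exact Finset.sum_congr rfl fun i _ => Finset.sum_congr rfl fun j _ => by
      rw [hτ.apply j i]; ring
  have h3 : realC x ⬝ᵥ (τ *ᵥ realC x) = ∑ i, ∑ j, (x i * x j : ℂ) * τ j i := by
    simp only [dotProduct, mulVec, Finset.mul_sum, realC]
    exact Finset.sum_congr rfl fun i _ => Finset.sum_congr rfl fun j _ => by
      rw [hτ.apply j i]; ring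
  have h4 : (fun i => (r i : ℂ)) ⬝ᵥ (τ *ᵥ realC x) =
      ∑ i, ∑ j, ((x i * r j + r i * x j) / 2 : ℂ) * τ j i := by
    have : (fun i => (r i : ℂ)) ⬝ᵥ (τ *ᵥ realC x) = ((fun i => (r i : ℂ)) ⬝ᵥ (τ *ᵥ realC x) +
      (fun i => (r i : ℂ)) ⬝ᵥ (τ *ᵥ realC x)) / 2 := by ring
    rw [this]
    nth_rewrite 1 [h1]
    rw [h2, ← Finset.sum_add_distrib, Finset.sum_div]
    refine Finset.sum_congr rfl fun i _ => ?_
    rw [← Finset.sum_add_distrib, Finset.sum_div]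
    exact Finset.sum_congr rfl fun j _ => by ring
  rw [h4, h3, Finset.mul_sum]
  simp only [trace, diag, mul_apply, toComplex_apply, twist_blockIndex_apply, map_apply,
    ← Finset.sum_add_distrib, Finset.mul_sum]
  refine Finset.sum_congr rfl fun i _ => Finset.sum_congr rfl fun j _ => ?_
  push_cast; ring

variable {φ : Matrix (Fin n) (Fin n) ℂ → (Fin n → ℂ) → ℂ} {m : ℕ}
  {a : Matrix (Fin n ⊕ Unit) (Fin n ⊕ Unit) ℚ → ℂ}

/-- The terms of the Fourier expansion at `z = τ x + y`. -/
noncomputable def twistTerm (m : ℕ) (a : Matrix (Fin n ⊕ Unit) (Fin n ⊕ Unit) ℚ → ℂ)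
    (τ : Matrix (Fin n) (Fin n) ℂ) (x y : Fin n → ℝ) (p : FourierIndex n) : ℂ :=
  a (blockIndex p.1.1 p.2 m) *
    e ((toComplex (twist x (blockIndex p.1.1 p.2 m)) * τ).trace +
      (fun i => (p.2 i : ℂ)) ⬝ᵥ realC y)

lemma norm_twistTerm (τ : Matrix (Fin n) (Fin n) ℂ) (x y : Fin n → ℝ) (p : FourierIndex n) :
    ‖twistTerm m a τ x y p‖ = ‖a (blockIndex p.1.1 p.2 m)‖ *
      Real.exp (-(2 * Real.pi * (twist x (blockIndex p.1.1 p.2 m) * imMat τ).trace)) := by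
  have h : ((fun i => (p.2 i : ℂ)) ⬝ᵥ realC y).im = 0 := by
    simp [dotProduct, realC, Complex.im_sum]
  rw [twistTerm, norm_mul, norm_e, Complex.add_im, trace_toComplex_mul_im, h, add_zero]

lemma hasSum_twistTerm
    (h : HasFourierExpansion φ fun s r => a (blockIndex s r m)) {τ : Matrix (Fin n) (Fin n) ℂ}
    (hτ : τ ∈ siegelUpperHalf (Fin n)) (x y : Fin n → ℝ) :
    HasSum (twistTerm m a τ x y)
      (φ τ (latticePoint τ x y) * e (m * (realC x ⬝ᵥ (τ *ᵥ realC x)))) := by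
  have h1 := (h τ hτ (latticePoint τ x y)).mul_right (e (m * (realC x ⬝ᵥ (τ *ᵥ realC x))))
  have h2 : twistTerm m a τ x y = fun p => a (blockIndex p.1.1 p.2 m) *
      e ((p.1.1.map (fun x : ℚ => (x : ℂ)) * τ).trace +
        (fun i => (p.2 i : ℂ)) ⬝ᵥ latticePoint τ x y) *
      e (m * (realC x ⬝ᵥ (τ *ᵥ realC x))) := by
    funext p
    rw [twistTerm, trace_twist_mul x _ _ _ hτ.1, mul_assoc, ← e_add, latticePoint, dotProduct_add]
    ring_nf
  rw [h2]
  exact h1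

lemma jacNorm_eq_norm_tsum {κ : ℤ}
    (h : HasFourierExpansion φ fun s r => a (blockIndex s r m)) {τ : Matrix (Fin n) (Fin n) ℂ}
    (hτ : τ ∈ siegelUpperHalf (Fin n)) (x y : Fin n → ℝ) :
    jacNorm κ m φ τ x y = ‖∑' p, twistTerm m a τ x y p‖ * (imMat τ).det ^ ((κ : ℝ) / 4) := by
  rw [(hasSum_twistTerm h hτ x y).tsum_eq, norm_mul, norm_e, ← Complex.ofReal_natCast,
    Complex.im_ofReal_mul, im_dotProduct_mulVec, jacNorm]

/-- The torsion coordinates `l / N`. -/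
noncomputable def divVec (N : ℕ) (l : Fin n → ℤ) : Fin n → ℝ := fun i => (l i : ℝ) / N

lemma exists_int_eq_trace_twist {N : ℕ} (hN : 0 < N) (l : Fin n → ℤ) (m : ℕ)
    (p : FourierIndex n) :
    ∃ k : ℤ, (k : ℝ) = N ^ 2 * (twist (divVec N l) (blockIndex p.1.1 p.2 m)).trace := by
  have hN' : (N : ℝ) ≠ 0 := by exact_mod_cast hN.ne'
  choose s hs using p.1.2.2.1
  refine ⟨∑ i, (N ^ 2 * s i + N * (p.2 i * l i) + m * (l i * l i)), ?_⟩
  simp only [trace, diag, twist_blockIndex_apply, divVec, hs, Finset.mul_sum]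
  push_cast
  refine Finset.sum_congr rfl fun i _ => ?_
  field_simp
  ring

lemma one_le_det_twist {N : ℕ} (hN : 0 < N) (l : Fin n → ℤ) (m : ℕ) (p : FourierIndex n)
    (hp : (ratR (blockIndex p.1.1 p.2 m)).PosDef) :
    ((2 * (N : ℝ) ^ 2)⁻¹) ^ n ≤ (twist (divVec N l) (blockIndex p.1.1 p.2 m)).det := by
  have hN' : (0 : ℝ) < N := by exact_mod_cast hN
  choose s hs using p.1.2.2.2
  let T : Matrix (Fin n) (Fin n) ℤ :=
    of fun i j => N ^ 2 * s i j + N * (l i * p.2 j + p.2 i * l j) + 2 * m * (l i * l j)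
  have hT : intR T = (2 * (N : ℝ) ^ 2) • twist (divVec N l) (blockIndex p.1.1 p.2 m) := by
    ext i j
    have h2 : (s i j : ℝ) = 2 * ((p.1.1 i j : ℚ) : ℝ) := by
      exact_mod_cast congrArg (fun q : ℚ => (q : ℝ)) (hs i j).symm
    simp only [map_apply, Matrix.smul_apply, smul_eq_mul, twist_blockIndex_apply, divVec, T,
      of_apply]
    push_cast
    rw [h2]
    field_simp
  have hdet : ((T.det : ℤ) : ℝ) =
      (2 * (N : ℝ) ^ 2) ^ n * (twist (divVec N l) (blockIndex p.1.1 p.2 m)).det := by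
    have h1 : (intR T).det = ((T.det : ℤ) : ℝ) := (RingHom.map_det (Int.castRingHom ℝ) T).symm
    rw [← h1, hT, det_smul, Fintype.card_fin]
  have hpos := (twist_posDef (divVec N l) hp).det_pos
  have h1 : (1 : ℝ) ≤ (T.det : ℤ) := by
    have : (0 : ℝ) < (T.det : ℤ) := by rw [hdet]; positivity
    exact_mod_cast this
  rw [inv_pow, inv_le_iff_one_le_mul₀' (by positivity)]
  rwa [hdet] at h1

/-- Powers of `det Y` are dominated by `exp (π tr (S Y))`. -/
lemma exists_det_rpow_mul_exp_le (n : ℕ) (β : ℝ) {c δ : ℝ} (hc : 0 < c) (hδ : 0 < δ) :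
    ∃ K : ℝ, 0 < K ∧ ∀ S Y : Matrix (Fin n) (Fin n) ℝ, S.PosDef → δ ≤ S.det → Y.PosDef →
      (Y - (2 * c) • 1).PosSemidef →
        Real.exp (-(Real.pi * (S * Y).trace)) * Y.det ^ β ≤ K := by
  rcases le_or_gt β 0 with hβ | hβ
  · refine ⟨(c ^ n) ^ β, by positivity, fun S Y hS _ hY hYc => ?_⟩
    have h1 := det_sub_smul_one_bounds (isSymm_of_posDef hY) hc hYc
    rw [Fintype.card_fin] at h1
    have h2 : c ^ n ≤ Y.det := h1.1.trans h1.2.1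
    have h3 := Real.rpow_le_rpow_of_nonpos (by positivity) h2 hβ
    have h4 : Real.exp (-(Real.pi * (S * Y).trace)) ≤ 1 := by
      rw [Real.exp_le_one_iff, neg_nonpos]
      exact mul_nonneg Real.pi_pos.le (trace_mul_nonneg hS.posSemidef hY.posSemidef)
    calc _ ≤ 1 * Y.det ^ β :=
          mul_le_mul_of_nonneg_right h4 (Real.rpow_nonneg hY.det_pos.le _)
      _ ≤ _ := by rw [one_mul]; exact h3
  · set η : ℝ := Real.pi / β with hη
    have hη0 : 0 < η := div_pos Real.pi_pos hβ
    refine ⟨((η ^ n * δ)⁻¹) ^ β, by positivity, fun S Y hS hSd hY _ => ?_⟩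
    have h1 := det_mul_det_le_exp_trace hS.posSemidef hY.posSemidef hη0
    rw [Fintype.card_fin] at h1
    have hYd := hY.det_pos
    have h2 : Y.det ≤ (η ^ n * δ)⁻¹ * Real.exp (η * (S * Y).trace) := by
      rw [← div_eq_inv_mul, le_div_iff₀ (by positivity)]
      refine le_trans ?_ h1
      have : Y.det * (η ^ n * δ) = η ^ n * (δ * Y.det) := by ring
      rw [this]
      gcongr
    have h3 := Real.rpow_le_rpow hYd.le h2 hβ.le
    rw [Real.mul_rpow (by positivity) (Real.exp_pos _).le, ← Real.exp_mul,
      show η * (S * Y).trace * β = Real.pi * (S * Y).trace by rw [hη]; field_simp] at h3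
    calc _ ≤ Real.exp (-(Real.pi * (S * Y).trace)) *
          (((η ^ n * δ)⁻¹) ^ β * Real.exp (Real.pi * (S * Y).trace)) := by gcongr
      _ = ((η ^ n * δ)⁻¹) ^ β *
          (Real.exp (-(Real.pi * (S * Y).trace)) * Real.exp (Real.pi * (S * Y).trace)) := by ring
      _ = _ := by rw [← Real.exp_add, neg_add_cancel, Real.exp_zero, mul_one]

end Twist

end FJ

namespace FJ

open Matrix

section SmallCoefficients

variable {n : ℕ} {φ : ℕ → Matrix (Fin n) (Fin n) ℂ → (Fin n → ℂ) → ℂ}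
  {a : Matrix (Fin n ⊕ Unit) (Fin n ⊕ Unit) ℚ → ℂ}

lemma summable_coeff_mul_exp {m : ℕ} {φ : Matrix (Fin n) (Fin n) ℂ → (Fin n → ℂ) → ℂ}
    (h : HasFourierExpansion φ fun s r => a (blockIndex s r m)) (x : Fin n → ℝ) {δ : ℝ}
    (hδ : 0 < δ) :
    Summable fun p : FourierIndex n => ‖a (blockIndex p.1.1 p.2 m)‖ *
      Real.exp (-(2 * Real.pi * (δ * (twist x (blockIndex p.1.1 p.2 m)).trace))) := by
  have hmem := scalar_mem_siegelUpperHalf (isSymm_zero (n := Fin n) (α := ℝ)) hδ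
  have h1 := (hasSum_twistTerm h hmem x 0).summable.norm
  convert h1 using 2 with p
  rw [norm_twistTerm]
  have h2 : imMat (toComplex 0 + (δ * Complex.I) • (1 : Matrix (Fin n) (Fin n) ℂ)) = δ • 1 := by
    ext i j
    simp [imMat, toComplex_apply, one_apply]
    split_ifs <;> simp
  rw [h2, Matrix.mul_smul, mul_one, trace_smul, smul_eq_mul]

lemma trace_conj_le {ι : Type*} [Fintype ι] {T : Matrix ι ι ℝ} (hT : T.PosSemidef)
    (u : Matrix ι ι ℝ) : (uᵀ * T * u).trace ≤ T.trace * ∑ j, (fun i => u i j) ⬝ᵥ fun i => u i j := by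
  have h1 (j : ι) : (uᵀ * T * u) j j = (fun i => u i j) ⬝ᵥ (T *ᵥ fun i => u i j) := by
    rw [Matrix.mul_assoc, mul_apply]; rfl
  simp only [trace, diag, h1, Finset.mul_sum]
  exact Finset.sum_le_sum fun j _ => quadForm_le_trace_mul hT _

lemma diag_le_twist {s : Matrix (Fin n) (Fin n) ℚ} {r : Fin n → ℤ} {m : ℕ}
    (hT : (ratR (blockIndex s r m)).PosDef) (x : Fin n → ℝ) (i : Fin n) :
    (s i i : ℝ) ≤ 2 * twist x (blockIndex s r m) i i + 2 * m * x i ^ 2 := by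
  have h1 := (twist_posDef (fun j => 2 * x j) hT).diag_pos (i := i)
  rw [twist_blockIndex_apply] at h1 ⊢
  push_cast at h1 ⊢
  linarith [sq_nonneg (x i)]

lemma intQuad_single {s : Matrix (Fin n) (Fin n) ℚ} {r : Fin n → ℤ} {m N : ℕ} (hN : 0 < N)
    (l : Fin n → ℤ) (i : Fin n) :
    intQuad (ratR (blockIndex s r m)) (Sum.elim (Pi.single i (N : ℤ)) fun _ => l i) =
      N ^ 2 * twist (divVec N l) (blockIndex s r m) i i := by
  have hN' : (N : ℝ) ≠ 0 := by exact_mod_cast hN.ne'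
  rw [twist_blockIndex_apply]
  have h (j : Fin n) : ((Pi.single i (N : ℤ) : Fin n → ℤ) j : ℝ) = if j = i then (N : ℝ) else 0 := by
    rcases eq_or_ne j i with rfl | hj
    · simp
    · simp [hj]
  simp [intQuad, dotProduct, mulVec, Fintype.sum_sum_type, blockIndex, h, divVec]
  field_simp
  ring

lemma conj_injective {ι : Type*} [Fintype ι] [DecidableEq ι] (u : GL ι ℤ) {t t' : Matrix ι ι ℚ}
    (h : (intQ u.1)ᵀ * t * intQ u.1 = (intQ u.1)ᵀ * t' * intQ u.1) : t = t' := by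
  have h1 : intQ u.1 * intQ u.2 = 1 := by
    rw [← intQ_mul]
    have : u.1 * u.2 = 1 := u.3
    rw [this]; ext i j; simp [one_apply]
  have h2 : (intQ u.2)ᵀ * (intQ u.1)ᵀ = 1 := by rw [← transpose_mul, h1, transpose_one]
  have key (s : Matrix ι ι ℚ) :
      (intQ u.2)ᵀ * ((intQ u.1)ᵀ * s * intQ u.1) * intQ u.2 = s := by
    rw [Matrix.mul_assoc (intQ u.1)ᵀ, ← Matrix.mul_assoc _ (intQ u.1)ᵀ, h2, Matrix.one_mul,
      Matrix.mul_assoc, h1, Matrix.mul_one]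
  rw [← key t, h, key]

/-- The Fourier coefficients with bounded index at a torsion point grow subexponentially
in `m`. -/
lemma exists_sum_small_coeff_le (hn : 1 ≤ n) (ha : IsCoeffFamily φ a) (hsym : IsNormSymmetric a)
    (hcusp : IsCuspidal φ) {N : ℕ} (hN : 0 < N) (l : Fin n → ℤ) (B : ℝ) {ε : ℝ} (hε : 0 < ε) :
    ∃ C : ℝ, ∀ (m : ℕ) (F : Finset (FourierIndex n)),
      (∀ p ∈ F, (twist (divVec N l) (blockIndex p.1.1 p.2 m)).trace ≤ B) →
        ∑ p ∈ F, ‖a (blockIndex p.1.1 p.2 m)‖ ≤ C * Real.exp (ε * m) := by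
  classical
  have hN' : (0 : ℝ) < N := by exact_mod_cast hN
  let i₀ : Fin n := ⟨0, hn⟩
  let v : Fin n ⊕ Unit → ℤ := Sum.elim (Pi.single i₀ (N : ℤ)) fun _ => l i₀
  obtain ⟨u, d, hu⟩ := exists_GL_col v (.inr ())
  have hd : d ≠ 0 := by
    rintro rfl
    have := hu (.inl i₀)
    simp [v] at this
    exact hN.ne' this
  set x := divVec N l with hx
  set U : ℝ := ∑ j, (fun i => (u.1 i j : ℝ)) ⬝ᵥ fun i => (u.1 i j : ℝ) with hU
  have hU0 : 0 ≤ U := Finset.sum_nonneg fun j _ => Finset.sum_nonneg fun i _ => mul_self_nonneg _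
  set W : ℝ := 2 * ∑ i, x i ^ 2 + 1 with hW
  have hW0 : 0 ≤ W := by positivity
  set δ : ℝ := ε / (2 * Real.pi * (U * W + 1)) with hδ
  have hδ0 : 0 < δ := by positivity
  have hδU : 2 * Real.pi * (δ * (U * W)) ≤ ε := by
    have h1 : 2 * Real.pi * (δ * (U * W + 1)) = ε := by
      rw [hδ]; field_simp
    have : 0 ≤ 2 * Real.pi * δ := by positivity
    nlinarith
  let K : ℕ := ⌊(N : ℝ) ^ 2 * B⌋₊
  let h (k : ℕ) (p : FourierIndex n) : ℝ := ‖a (blockIndex p.1.1 p.2 k)‖ *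
    Real.exp (-(2 * Real.pi * (δ * (twist 0 (blockIndex p.1.1 p.2 k)).trace)))
  have hsum (k : ℕ) : Summable (h k) := summable_coeff_mul_exp (ha.1 k) 0 hδ0
  have h0 (k : ℕ) (p : FourierIndex n) : 0 ≤ h k p := by positivity
  refine ⟨Real.exp (2 * Real.pi * (δ * (U * (2 * B)))) * ∑ k ∈ Finset.range (K + 1), ∑' p, h k p,
    fun m F hF => ?_⟩
  let F' := F.filter fun p => a (blockIndex p.1.1 p.2 m) ≠ 0
  have hFF' : ∑ p ∈ F, ‖a (blockIndex p.1.1 p.2 m)‖ = ∑ p ∈ F', ‖a (blockIndex p.1.1 p.2 m)‖ := by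
    refine (Finset.sum_subset (Finset.filter_subset _ _) fun p hp hp' => ?_).symm
    simpa [F', hp] using hp'
  have hex (p : FourierIndex n) : ∃ q : ℕ × FourierIndex n, p ∈ F' →
      (intQ u.1)ᵀ * blockIndex p.1.1 p.2 m * intQ u.1 = blockIndex q.2.1.1 q.2.2 q.1 ∧
      q.1 ≤ K ∧ (twist 0 (blockIndex q.2.1.1 q.2.2 q.1)).trace ≤ U * (2 * B + W * m) := by
    by_cases hp : p ∈ F'
    swap
    · exact ⟨(0, p), fun h => (hp h).elim⟩
    obtain ⟨hpF, hp0⟩ := Finset.mem_filter.mp hp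
    have hth : IsHalfIntegral (blockIndex p.1.1 p.2 (m : ℚ)) := by
      have := isHalfIntegral_blockIndex p.1.2 p.2 (m : ℤ)
      simpa using this
    have hT := posDef_of_coeff_ne_zero ha hsym hcusp hth hp0
    set t := blockIndex p.1.1 p.2 (m : ℚ) with ht
    set t' := (intQ u.1)ᵀ * t * intQ u.1 with ht'
    have hth' : IsHalfIntegral t' := hth.conj u.1
    have ha' : a t' ≠ 0 := by rw [← norm_ne_zero_iff, hsym u t hth, norm_ne_zero_iff]; exact hp0
    have hT' := posDef_of_coeff_ne_zero ha hsym hcusp hth' ha'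
    obtain ⟨k, hk⟩ := hth'.2.1 (.inr ())
    have hkpos : (0 : ℝ) < k := by
      have := hT'.diag_pos (i := .inr ())
      simp only [map_apply, hk] at this
      exact_mod_cast this
    obtain ⟨q, hq⟩ := hth'.exists_blockIndex
    have hk' : ((k.toNat : ℕ) : ℤ) = k := Int.toNat_of_nonneg (by exact_mod_cast hkpos.le)
    have hkq : t' (.inr ()) (.inr ()) = ((k.toNat : ℕ) : ℚ) := by
      rw [hk]; exact_mod_cast hk'.symm
    rw [hkq] at hq
    refine ⟨(k.toNat, q), fun _ => ⟨hq, ?_, ?_⟩⟩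
    · refine Nat.le_floor ?_
      have e1 : ((k.toNat : ℕ) : ℝ) = k := by exact_mod_cast hk'
      have e2 : intQuad (ratR t) v = d ^ 2 * k := by
        have hvi (i) : (v i : ℝ) = d * (u.1 i (.inr ()) : ℝ) := by rw [hu i]; push_cast; rfl
        have e3 : (k : ℝ) = ((t' (.inr ()) (.inr ()) : ℚ) : ℝ) := by rw [hk]; simp
        rw [e3, ht', Matrix.mul_assoc, mul_apply]
        simp only [intQuad, dotProduct, mulVec, mul_apply, transpose_apply, map_apply, hvi]
        push_cast
        simp only [Finset.mul_sum]
        exact Finset.sum_congr rfl fun i _ => Finset.sum_congr rfl fun j _ => by ring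
      have e3 := intQuad_single (s := p.1.1) (r := p.2) (m := m) hN l i₀
      rw [← ht, e2] at e3
      have e4 : twist x t i₀ i₀ ≤ B := by
        refine le_trans ?_ (hF p hpF)
        exact Finset.single_le_sum (f := fun i => twist x t i i)
          (fun i _ => (twist_posDef x hT).diag_pos.le) (Finset.mem_univ i₀)
      have e5 : (1 : ℝ) ≤ (d : ℝ) ^ 2 := by
        have : (1 : ℤ) ≤ d ^ 2 := Order.one_le_iff_pos.mpr (by positivity)
        exact_mod_cast this
      rw [e1]
      calc (k : ℝ) = 1 * k := (one_mul _).symm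
        _ ≤ d ^ 2 * k := by gcongr
        _ = N ^ 2 * twist x t i₀ i₀ := e3
        _ ≤ N ^ 2 * B := by gcongr
    · have e1 : (twist 0 (blockIndex q.1.1 q.2 ((k.toNat : ℕ) : ℚ))).trace ≤ (ratR t').trace := by
        rw [← hq, trace, trace, Fintype.sum_sum_type]
        have : (twist 0 t').diag = fun i => (ratR t').diag (.inl i) := by
          ext i
          rw [diag, hq, twist_blockIndex_apply]
          simp [blockIndex]
        rw [this]
        refine le_add_of_nonneg_right (Finset.sum_nonneg fun i _ => hT'.diag_pos.le)
      have e2 : ratR t' = (intR u.1)ᵀ * ratR t * intR u.1 := by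
        ext i j
        simp [ht', mul_apply]
      have e3 : (ratR t').trace ≤ (ratR t).trace * U := by
        rw [e2]; exact trace_conj_le hT.posSemidef _
      have e4 : (ratR t).trace ≤ 2 * B + W * m := by
        have e5 : (ratR t).trace = ∑ i, (p.1.1 i i : ℝ) + m := by
          simp [trace, Fintype.sum_sum_type, ht, blockIndex]
        have e6 : ∑ i, (p.1.1 i i : ℝ) ≤ 2 * (twist x t).trace + 2 * m * ∑ i, x i ^ 2 := by
          rw [trace, Finset.mul_sum, Finset.mul_sum, ← Finset.sum_add_distrib]
          exact Finset.sum_le_sum fun i _ => diag_le_twist hT x i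
        have e7 := hF p hpF
        rw [e5, hW]
        linarith
      calc _ ≤ (ratR t').trace := e1
        _ ≤ (ratR t).trace * U := e3
        _ ≤ (2 * B + W * m) * U := by gcongr
        _ = _ := mul_comm _ _
  choose g hg using hex
  have hterm (p : FourierIndex n) (hp : p ∈ F') : ‖a (blockIndex p.1.1 p.2 m)‖ ≤
      h (g p).1 (g p).2 *
        (Real.exp (2 * Real.pi * (δ * (U * (2 * B)))) * Real.exp (ε * m)) := by
    obtain ⟨h1, -, h3⟩ := hg p hp
    have hth : IsHalfIntegral (blockIndex p.1.1 p.2 (m : ℚ)) := by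
      have := isHalfIntegral_blockIndex p.1.2 p.2 (m : ℤ)
      simpa using this
    rw [← hsym u _ hth, h1]
    simp only [h]
    rw [mul_assoc, ← Real.exp_add, ← Real.exp_add]
    refine le_mul_of_one_le_right (norm_nonneg _) (Real.one_le_exp ?_)
    have h4 : 2 * Real.pi * (δ * (twist 0 (blockIndex (g p).2.1.1 (g p).2.2 (g p).1)).trace) ≤
        2 * Real.pi * (δ * (U * (2 * B + W * m))) := by gcongr
    have h5 : 2 * Real.pi * (δ * (U * (2 * B + W * m))) =
        2 * Real.pi * (δ * (U * (2 * B))) + 2 * Real.pi * (δ * (U * W)) * m := by ring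
    have h6 : 2 * Real.pi * (δ * (U * W)) * m ≤ ε * m := by gcongr
    linarith
  have hinj : Set.InjOn g F' := by
    intro p hp q hq hpq
    have h1 := (hg p hp).1
    rw [hpq, ← (hg q hq).1] at h1
    exact blockIndex_injective (conj_injective u h1)
  rw [hFF']
  calc ∑ p ∈ F', ‖a (blockIndex p.1.1 p.2 m)‖
      ≤ ∑ p ∈ F', h (g p).1 (g p).2 *
        (Real.exp (2 * Real.pi * (δ * (U * (2 * B)))) * Real.exp (ε * m)) :=
        Finset.sum_le_sum hterm
    _ = (∑ q ∈ F'.image g, h q.1 q.2) *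
        (Real.exp (2 * Real.pi * (δ * (U * (2 * B)))) * Real.exp (ε * m)) := by
        rw [Finset.sum_image hinj, ← Finset.sum_mul]
    _ ≤ (∑ k ∈ Finset.range (K + 1), ∑' p, h k p) *
        (Real.exp (2 * Real.pi * (δ * (U * (2 * B)))) * Real.exp (ε * m)) := by
        refine mul_le_mul_of_nonneg_right ?_ (by positivity)
        calc ∑ q ∈ F'.image g, h q.1 q.2
            ≤ ∑ q ∈ Finset.range (K + 1) ×ˢ (F'.image g).image Prod.snd, h q.1 q.2 := by
              refine Finset.sum_le_sum_of_subset_of_nonneg (fun q hq => ?_) fun q _ _ => h0 _ _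
              refine Finset.mem_product.mpr ⟨?_, Finset.mem_image_of_mem _ hq⟩
              obtain ⟨p, hp, rfl⟩ := Finset.mem_image.mp hq
              exact Finset.mem_range.mpr (Nat.lt_succ_of_le (hg p hp).2.1)
          _ = ∑ k ∈ Finset.range (K + 1), ∑ p ∈ (F'.image g).image Prod.snd, h k p :=
              Finset.sum_product _ _ _
          _ ≤ _ := Finset.sum_le_sum fun k _ =>
              (hsum k).sum_le_tsum _ fun p _ => h0 k p
    _ = _ := by ring

end SmallCoefficients

end FJ

namespace FJ

open Matrix

section Growth

variable {n : ℕ} {κ : ℤ} {φ : ℕ → Matrix (Fin n) (Fin n) ℂ → (Fin n → ℂ) → ℂ}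
  {a : Matrix (Fin n ⊕ Unit) (Fin n ⊕ Unit) ℚ → ℂ}

lemma isHalfIntegral_blockIndex_nat (p : FourierIndex n) (m : ℕ) :
    IsHalfIntegral (blockIndex p.1.1 p.2 (m : ℚ)) := by
  simpa using isHalfIntegral_blockIndex p.1.2 p.2 (m : ℤ)

/-- On the region `Im τ ≥ 2 c` the terms of the Fourier expansion at a torsion point are uniformly
small compared to powers of `det (Im τ)`. -/
lemma exists_norm_twistTerm_mul_le (ha : IsCoeffFamily φ a) (hsym : IsNormSymmetric a)
    (hcusp : IsCuspidal φ) (κ : ℤ) {N : ℕ} (hN : 0 < N) {c : ℝ} (hc : 0 < c) :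
    ∃ K : ℝ, 0 < K ∧ ∀ (m : ℕ) (l : Fin n → ℤ), ∀ τ ∈ siegelUpperHalf (Fin n),
      (imMat τ - (2 * c) • 1).PosSemidef → ∀ (y : Fin n → ℝ) (p : FourierIndex n),
        ‖twistTerm m a τ (divVec N l) y p‖ * (imMat τ).det ^ ((κ : ℝ) / 4) ≤
          K * (‖a (blockIndex p.1.1 p.2 m)‖ * Real.exp (-(2 * Real.pi *
            (c * (twist (divVec N l) (blockIndex p.1.1 p.2 m)).trace)))) := by
  have hN' : (0 : ℝ) < N := by exact_mod_cast hN
  obtain ⟨K, hK, hb⟩ := exists_det_rpow_mul_exp_le n ((κ : ℝ) / 4) hc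
    (show 0 < ((2 * (N : ℝ) ^ 2)⁻¹) ^ n by positivity)
  refine ⟨K, hK, fun m l τ hτ hY y p => ?_⟩
  by_cases h0 : a (blockIndex p.1.1 p.2 m) = 0
  · simp [norm_twistTerm, h0]
  have hT := posDef_of_coeff_ne_zero ha hsym hcusp (isHalfIntegral_blockIndex_nat p m) h0
  set S := twist (divVec N l) (blockIndex p.1.1 p.2 (m : ℚ)) with hS
  have hSp : S.PosDef := twist_posDef _ hT
  have h1 := hb S (imMat τ) hSp (one_le_det_twist hN l m p hT) hτ.2 hY
  have h2 : 2 * c * S.trace ≤ (S * imMat τ).trace := by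
    have := trace_mul_nonneg hSp.posSemidef hY
    rw [Matrix.mul_sub, trace_sub, Matrix.mul_smul, mul_one, trace_smul, smul_eq_mul] at this
    linarith
  have h3 : Real.exp (-(2 * Real.pi * (S * imMat τ).trace)) ≤
      Real.exp (-(Real.pi * (S * imMat τ).trace)) * Real.exp (-(2 * Real.pi * (c * S.trace))) := by
    rw [← Real.exp_add, Real.exp_le_exp]
    nlinarith [Real.pi_pos]
  rw [norm_twistTerm, ← hS]
  have hd : 0 ≤ (imMat τ).det ^ ((κ : ℝ) / 4) := Real.rpow_nonneg hτ.2.det_pos.le _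
  calc _ ≤ ‖a (blockIndex p.1.1 p.2 m)‖ * (Real.exp (-(Real.pi * (S * imMat τ).trace)) *
        Real.exp (-(2 * Real.pi * (c * S.trace)))) * (imMat τ).det ^ ((κ : ℝ) / 4) := by gcongr
    _ = (Real.exp (-(Real.pi * (S * imMat τ).trace)) * (imMat τ).det ^ ((κ : ℝ) / 4)) *
        (‖a (blockIndex p.1.1 p.2 m)‖ * Real.exp (-(2 * Real.pi * (c * S.trace)))) := by ring
    _ ≤ _ := by gcongr

lemma exists_jacNorm_le (ha : IsCoeffFamily φ a) (hsym : IsNormSymmetric a)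
    (hcusp : IsCuspidal φ) (κ : ℤ) {N : ℕ} (hN : 0 < N) {c : ℝ} (hc : 0 < c) (m : ℕ)
    (l : Fin n → ℤ) : ∃ M : ℝ, ∀ τ ∈ siegelUpperHalf (Fin n),
      (imMat τ - (2 * c) • 1).PosSemidef → ∀ y : Fin n → ℝ,
        jacNorm κ m (φ m) τ (divVec N l) y ≤ M := by
  obtain ⟨K, hK, hb⟩ := exists_norm_twistTerm_mul_le ha hsym hcusp κ hN hc
  refine ⟨K * ∑' p : FourierIndex n, ‖a (blockIndex p.1.1 p.2 m)‖ * Real.exp (-(2 * Real.pi *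
    (c * (twist (divVec N l) (blockIndex p.1.1 p.2 m)).trace))), fun τ hτ hY y => ?_⟩
  have hs := (hasSum_twistTerm (ha.1 m) hτ (divVec N l) y).summable.norm
  have hs' := summable_coeff_mul_exp (ha.1 m) (divVec N l) hc
  have hd : 0 ≤ (imMat τ).det ^ ((κ : ℝ) / 4) := Real.rpow_nonneg hτ.2.det_pos.le _
  rw [jacNorm_eq_norm_tsum (ha.1 m) hτ, ← tsum_mul_left]
  calc _ ≤ (∑' p, ‖twistTerm m a τ (divVec N l) y p‖) * (imMat τ).det ^ ((κ : ℝ) / 4) := by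
        gcongr
        exact norm_tsum_le_tsum_norm hs
    _ = ∑' p, ‖twistTerm m a τ (divVec N l) y p‖ * (imMat τ).det ^ ((κ : ℝ) / 4) :=
        tsum_mul_right.symm
    _ ≤ _ := (hs.mul_right _).tsum_le_tsum (fun p => hb m l τ hτ hY y p) (hs'.mul_left K)

/-- A power series tail bound for series graded by the integers. -/
lemma norm_tsum_tail_le {P : Type*} {c : P → ℂ} (hc : Summable fun p => ‖c p‖) (ν : P → ℤ)
    {F θ : ℝ} (hF0 : 0 ≤ F) (hF : ∀ k : ℤ, ‖∑' p : {p // ν p = k}, c p‖ ≤ F) (hθ0 : 0 < θ)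
    (hθ1 : θ < 1) (B : ℕ) :
    ‖∑' p, if (B : ℤ) < ν p then c p * (θ : ℂ) ^ ν p else 0‖ ≤ F * (θ ^ B / (1 - θ)) := by
  classical
  let b (p : P) : ℂ := if (B : ℤ) < ν p then c p * (θ : ℂ) ^ ν p else 0
  let w (k : ℤ) : ℝ := if (B : ℤ) < k then F * θ ^ k else 0
  have hbn (p : P) : ‖b p‖ ≤ ‖c p‖ := by
    simp only [b]
    split_ifs with h
    · rw [norm_mul, norm_zpow, Complex.norm_real, Real.norm_eq_abs, abs_of_pos hθ0]
      refine mul_le_of_le_one_right (norm_nonneg _) ?_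
      obtain ⟨k, hk⟩ := Int.eq_ofNat_of_zero_le (show 0 ≤ ν p by omega)
      rw [hk, zpow_natCast]
      exact pow_le_one₀ hθ0.le hθ1.le
    · simp
  have hb : Summable b := Summable.of_norm_bounded hc hbn
  have hfib := hb.hasSum.tsum_fiberwise ν
  have hw : HasSum w (F * (θ ^ (B + 1) / (1 - θ))) := by
    let g : ℕ → ℤ := fun j => (B + 1 + j : ℤ)
    have hg : Function.Injective g := fun i j h => by simpa [g] using h
    have h1 : HasSum (w ∘ g) (F * (θ ^ (B + 1) / (1 - θ))) := by
      have h2 := ((hasSum_geometric_of_lt_one hθ0.le hθ1).mul_left (θ ^ (B + 1))).mul_left F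
      rw [← div_eq_mul_inv] at h2
      have h3 : w ∘ g = fun j => F * (θ ^ (B + 1) * θ ^ j) := funext fun j => by
        have h4 : (B : ℤ) < B + 1 + j := by omega
        simp only [w, g, Function.comp_apply, if_pos h4]
        rw [← pow_add, ← zpow_natCast]
        push_cast
        rfl
      rw [h3]
      exact h2
    refine (hg.hasSum_iff fun k hk => ?_).mp h1
    simp only [w]
    rw [if_neg]
    intro hk'
    exact hk ⟨(k - B - 1).toNat, by simp only [g]; omega⟩
  have hle (k : ℤ) : ‖∑' p : ν ⁻¹' {k}, b p‖ ≤ w k := by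
    have h1 : (fun p : ν ⁻¹' {k} => b p) = fun p : ν ⁻¹' {k} =>
        (if (B : ℤ) < k then (θ : ℂ) ^ k else 0) * c p := by
      funext p
      have : ν p.1 = k := p.2
      simp only [b, this]
      split_ifs <;> ring
    rw [h1, tsum_mul_left, norm_mul]
    simp only [w]
    split_ifs with h
    · rw [norm_zpow, Complex.norm_real, Real.norm_eq_abs, abs_of_pos hθ0, mul_comm]
      exact mul_le_mul_of_nonneg_right (hF k) (by positivity)
    · simp
  have h1 : ‖∑' p, b p‖ ≤ F * (θ ^ (B + 1) / (1 - θ)) := by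
    rw [← hfib.tsum_eq]
    exact tsum_of_norm_bounded hw hle
  refine h1.trans ?_
  have h2 : θ ^ (B + 1) ≤ θ ^ B := pow_le_pow_of_le_one hθ0.le hθ1.le (Nat.le_succ B)
  have h3 : 0 < 1 - θ := by linarith
  gcongr

lemma rpow_ratio_le {x y R β : ℝ} (hy : 0 < y) (hyx : y ≤ x) (hx : x ≤ R * y) :
    x ^ β * y ^ (-β) ≤ R ^ |β| := by
  have h1 : 1 ≤ x / y := (one_le_div hy).mpr hyx
  have h2 : x / y ≤ R := (div_le_iff₀ hy).mpr hx
  have hx0 : 0 ≤ x := hy.le.trans hyx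
  rw [Real.rpow_neg hy.le, ← div_eq_mul_inv, ← Real.div_rpow hx0 hy.le]
  calc (x / y) ^ β ≤ (x / y) ^ |β| := Real.rpow_le_rpow_of_exponent_le h1 (le_abs_self β)
    _ ≤ R ^ |β| := Real.rpow_le_rpow (by positivity) h2 (abs_nonneg β)

/-- The shift `τ - i c + x` stays in the upper half space if `Im τ ≥ 2 c`. -/
lemma shift_mem_siegelUpperHalf {τ : Matrix (Fin n) (Fin n) ℂ} (hτ : τ ∈ siegelUpperHalf (Fin n))
    {c : ℝ} (hc : 0 < c) (hY : (imMat τ - (2 * c) • 1).PosSemidef) (x : ℝ) :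
    τ + ((x : ℂ) - c * Complex.I) • (1 : Matrix (Fin n) (Fin n) ℂ) ∈ siegelUpperHalf (Fin n) ∧
      imMat (τ + ((x : ℂ) - c * Complex.I) • (1 : Matrix (Fin n) (Fin n) ℂ)) =
        imMat τ - c • 1 := by
  have him : imMat (τ + ((x : ℂ) - c * Complex.I) • (1 : Matrix (Fin n) (Fin n) ℂ)) =
      imMat τ - c • 1 := by
    ext i j
    simp [imMat, one_apply]
    split_ifs <;> simp [sub_eq_add_neg]
  refine ⟨⟨hτ.1.add (isSymm_one.smul _), ?_⟩, him⟩
  rw [him, show imMat τ - c • (1 : Matrix (Fin n) (Fin n) ℝ) =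
    (imMat τ - (2 * c) • 1) + c • 1 by rw [two_mul, add_smul]; abel]
  exact PosDef.posSemidef_add hY (PosDef.one.smul hc)

/-- The key estimate: the invariant norm at a point of the reduced region is bounded by half of
its supremum, up to the contribution of finitely many Fourier coefficients. -/
lemma exists_jacNorm_le_half (ha : IsCoeffFamily φ a) (hsym : IsNormSymmetric a)
    (hcusp : IsCuspidal φ) (κ : ℤ) {N : ℕ} (hN : 0 < N) {c : ℝ} (hc : 0 < c) :
    ∃ (K : ℝ) (B : ℝ), 0 < K ∧ ∀ (m : ℕ) (l : Fin n → ℤ) (y : Fin n → ℝ) (M Λ : ℝ),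
      (∀ τ ∈ siegelUpperHalf (Fin n), jacNorm κ m (φ m) τ (divVec N l) y ≤ M) →
      (∀ F : Finset (FourierIndex n),
        (∀ p ∈ F, (twist (divVec N l) (blockIndex p.1.1 p.2 m)).trace ≤ B) →
          ∑ p ∈ F, ‖a (blockIndex p.1.1 p.2 m)‖ ≤ Λ) →
      ∀ τ ∈ siegelUpperHalf (Fin n), (imMat τ - (2 * c) • 1).PosSemidef →
        jacNorm κ m (φ m) τ (divVec N l) y ≤ M / 2 + K * Λ := by
  classical
  have hN' : (0 : ℝ) < N := by exact_mod_cast hN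
  obtain ⟨K, hK, hb⟩ := exists_norm_twistTerm_mul_le ha hsym hcusp κ hN hc
  set θ : ℝ := Real.exp (-(2 * Real.pi * (c / N ^ 2))) with hθ
  have hθ0 : 0 < θ := Real.exp_pos _
  have hθ1 : θ < 1 := by
    rw [hθ, Real.exp_lt_one_iff, neg_lt_zero]; positivity
  set R : ℝ := ((2 : ℝ) ^ n) ^ |(κ : ℝ) / 4| with hR
  have hR0 : 0 < R := by positivity
  obtain ⟨B, hB⟩ := exists_pow_lt_of_lt_one
    (show 0 < (1 - θ) / (2 * R) from div_pos (by linarith) (by positivity)) hθ1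
  refine ⟨K, B / N ^ 2, hK, fun m l y M Λ hM hΛ τ hτ hY => ?_⟩
  choose ν hν using exists_int_eq_trace_twist hN l m
  set x := divVec N l with hx
  set D : ℝ := (imMat τ).det ^ ((κ : ℝ) / 4) with hD
  have hD0 : 0 < D := Real.rpow_pos_of_pos hτ.2.det_pos _
  have hdet := det_sub_smul_one_bounds (isSymm_imMat hτ.1) hc hY
  rw [Fintype.card_fin] at hdet
  have hdet0 : 0 < (imMat τ - c • 1).det := lt_of_lt_of_le (by positivity) hdet.1
  set D' : ℝ := (imMat τ - c • 1).det ^ ((κ : ℝ) / 4) with hD'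
  have hD'0 : 0 < D' := Real.rpow_pos_of_pos hdet0 _
  have hDD' : D * D'⁻¹ ≤ R := by
    rw [hD', ← Real.rpow_neg hdet0.le]
    exact rpow_ratio_le hdet0 hdet.2.1 hdet.2.2
  have hM0 : 0 ≤ M := le_trans (by
    rw [jacNorm]; have := hD0.le; positivity) (hM τ hτ)
  have hsh := shift_mem_siegelUpperHalf hτ hc hY
  let c₀ (p : FourierIndex n) : ℂ :=
    twistTerm m a (τ + (((0 : ℝ) : ℂ) - c * Complex.I) • 1) x y p
  have hc₀ : Summable fun p => ‖c₀ p‖ :=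
    (hasSum_twistTerm (ha.1 m) (hsh 0).1 x y).summable.norm
  have htr (p : FourierIndex n) (w : ℂ) (τ : Matrix (Fin n) (Fin n) ℂ) :
      (toComplex (twist x (blockIndex p.1.1 p.2 (m : ℚ))) * (τ + w • 1)).trace =
        (toComplex (twist x (blockIndex p.1.1 p.2 (m : ℚ))) * τ).trace + (ν p : ℂ) * (w / N ^ 2) := by
    have h1 : (toComplex (twist x (blockIndex p.1.1 p.2 (m : ℚ)))).trace =
        ((twist x (blockIndex p.1.1 p.2 (m : ℚ))).trace : ℂ) := by
      simp [trace, toComplex_apply]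
    have h2 : (ν p : ℂ) = N ^ 2 * ((twist x (blockIndex p.1.1 p.2 (m : ℚ))).trace : ℂ) := by
      exact_mod_cast congrArg (fun r : ℝ => (r : ℂ)) (hν p)
    have hNC : (N : ℂ) ≠ 0 := by exact_mod_cast hN.ne'
    rw [Matrix.mul_add, trace_add, Matrix.mul_smul, mul_one, trace_smul, smul_eq_mul, h1, h2]
    field_simp
  have hfib (k : ℤ) : ‖∑' p : {p // ν p = k}, c₀ p‖ ≤ M * D'⁻¹ := by
    have h1 := norm_tsum_fiber_le (D := Unit) hc₀ (fun p _ => ν p) (F := M * D'⁻¹)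
      (fun t => ?_) (fun _ => k)
    · have h2 (p) : ((fun _ : Unit => ν p) = fun _ => k) ↔ ν p = k :=
        ⟨fun h => congrFun h (), fun h => by rw [h]⟩
      have h3 : ∑' p : {p // (fun _ : Unit => ν p) = fun _ => k}, c₀ p =
          ∑' p : {p // ν p = k}, c₀ p :=
        (Equiv.subtypeEquivRight h2).tsum_eq (fun p : {p // ν p = k} => c₀ p)
      rwa [h3] at h1
    · have h2 (p : FourierIndex n) : c₀ p * e (∑ d, (ν p : ℂ) * t d) =
          twistTerm m a (τ + (((N ^ 2 * t () : ℝ) : ℂ) - c * Complex.I) • 1) x y p := by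
        have hNC : (N : ℂ) ≠ 0 := by exact_mod_cast hN.ne'
        simp only [c₀, twistTerm]
        rw [mul_assoc, ← e_add, htr, htr]
        congr 2
        simp only [Finset.univ_unique, Finset.sum_singleton]
        push_cast
        field_simp
        ring_nf
      simp only [h2]
      have h3 := hM _ (hsh (N ^ 2 * t ())).1
      rw [jacNorm_eq_norm_tsum (ha.1 m) (hsh _).1, (hsh _).2, ← hD'] at h3
      rwa [← div_eq_mul_inv, le_div_iff₀ hD'0]
  have htail := norm_tsum_tail_le hc₀ ν (by positivity) hfib hθ0 hθ1 B
  have hterm (p : FourierIndex n) : twistTerm m a τ x y p = c₀ p * (θ : ℂ) ^ ν p := by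
    have h1 : τ = (τ + (((0 : ℝ) : ℂ) - c * Complex.I) • 1) + ((c : ℂ) * Complex.I) • 1 := by
      simp
    have h2 : (θ : ℂ) ^ ν p = e ((ν p : ℂ) * ((c : ℂ) * Complex.I / N ^ 2)) := by
      rw [hθ, Complex.ofReal_exp, ← Complex.exp_int_mul, e]
      congr 1
      push_cast
      ring_nf
      simp only [Complex.I_sq]
      ring
    rw [h2]
    simp only [c₀, twistTerm]
    rw [mul_assoc, ← e_add]
    congr 2
    conv_lhs => rw [h1]
    rw [htr p (c * Complex.I)]
    ring
  have hsumτ := (hasSum_twistTerm (ha.1 m) hτ x y).summable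
  let b₁ (p : FourierIndex n) : ℂ := if (B : ℤ) < ν p then 0 else twistTerm m a τ x y p
  let b₂ (p : FourierIndex n) : ℂ := if (B : ℤ) < ν p then c₀ p * (θ : ℂ) ^ ν p else 0
  have hb₁ : Summable fun p => ‖b₁ p‖ := by
    refine Summable.of_nonneg_of_le (fun _ => norm_nonneg _) (fun p => ?_) hsumτ.norm
    simp only [b₁]
    split_ifs <;> simp
  have hb₂ : Summable b₂ := by
    refine Summable.of_norm_bounded hsumτ.norm fun p => ?_
    simp only [b₂, hterm]
    split_ifs
    · exact le_rfl
    · rw [norm_zero]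
      exact norm_nonneg _
  have hsplit : ∑' p, twistTerm m a τ x y p = ∑' p, b₁ p + ∑' p, b₂ p := by
    rw [← hb₁.of_norm.tsum_add hb₂]
    refine tsum_congr fun p => ?_
    simp only [b₁, b₂, hterm]
    split_ifs <;> simp
  have hΛ0 : 0 ≤ Λ := by simpa using hΛ ∅ (by simp)
  have hfirst : ‖∑' p, b₁ p‖ * D ≤ K * Λ := by
    have h1 : ‖∑' p, b₁ p‖ * D ≤ ∑' p, ‖b₁ p‖ * D := by
      rw [tsum_mul_right]
      exact mul_le_mul_of_nonneg_right (norm_tsum_le_tsum_norm hb₁) hD0.le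
    refine h1.trans (Summable.tsum_le_of_sum_le (hb₁.mul_right D) fun F => ?_)
    let F' := F.filter fun p => ν p ≤ B ∧ a (blockIndex p.1.1 p.2 m) ≠ 0
    have h2 : ∑ p ∈ F, ‖b₁ p‖ * D = ∑ p ∈ F', ‖b₁ p‖ * D := by
      refine (Finset.sum_subset (Finset.filter_subset _ _) fun p hp hp' => ?_).symm
      by_cases h : (B : ℤ) < ν p
      · simp [b₁, h]
      · have h3 : a (blockIndex p.1.1 p.2 m) = 0 := by
          by_contra h4
          exact hp' (Finset.mem_filter.mpr ⟨hp, not_lt.mp h, h4⟩)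
        simp [b₁, h, twistTerm, h3]
    rw [h2]
    calc ∑ p ∈ F', ‖b₁ p‖ * D ≤ ∑ p ∈ F', K * ‖a (blockIndex p.1.1 p.2 m)‖ := by
          refine Finset.sum_le_sum fun p hp => ?_
          obtain ⟨-, hp1, hp2⟩ := Finset.mem_filter.mp hp
          have hT := posDef_of_coeff_ne_zero ha hsym hcusp (isHalfIntegral_blockIndex_nat p m) hp2
          simp only [b₁, if_neg (not_lt.mpr hp1)]
          refine (hb m l τ hτ hY y p).trans ?_
          refine mul_le_mul_of_nonneg_left (mul_le_of_le_one_right (norm_nonneg _) ?_) hK.le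
          rw [Real.exp_le_one_iff, neg_nonpos]
          have := (twist_posDef (divVec N l) hT).posSemidef.trace_nonneg
          have := Real.pi_pos
          positivity
      _ = K * ∑ p ∈ F', ‖a (blockIndex p.1.1 p.2 m)‖ := by rw [Finset.mul_sum]
      _ ≤ K * Λ := by
          refine mul_le_mul_of_nonneg_left (hΛ F' fun p hp => ?_) hK.le
          obtain ⟨-, hp1, -⟩ := Finset.mem_filter.mp hp
          rw [le_div_iff₀ (by positivity), mul_comm, ← hν p]
          exact_mod_cast hp1
  have hsecond : ‖∑' p, b₂ p‖ * D ≤ M / 2 := by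
    have h1 : 0 < 1 - θ := by linarith
    have h2 : R * (θ ^ B / (1 - θ)) ≤ 1 / 2 := by
      rw [lt_div_iff₀ (by positivity)] at hB
      rw [← mul_div_assoc, div_le_iff₀ h1]
      linarith
    calc ‖∑' p, b₂ p‖ * D ≤ M * D'⁻¹ * (θ ^ B / (1 - θ)) * D :=
          mul_le_mul_of_nonneg_right htail hD0.le
      _ = M * ((D * D'⁻¹) * (θ ^ B / (1 - θ))) := by ring
      _ ≤ M * (R * (θ ^ B / (1 - θ))) := by gcongr
      _ ≤ M * (1 / 2) := by gcongr
      _ = M / 2 := by ring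
  rw [jacNorm_eq_norm_tsum (ha.1 m) hτ, hsplit, ← hD]
  calc ‖∑' p, b₁ p + ∑' p, b₂ p‖ * D ≤ (‖∑' p, b₁ p‖ + ‖∑' p, b₂ p‖) * D := by
        gcongr; exact norm_add_le _ _
    _ ≤ M / 2 + K * Λ := by rw [add_mul]; linarith

end Growth

end FJ

namespace FJ

open Matrix

section Reduction

variable {n : ℕ} {κ : ℤ} {φ : ℕ → Matrix (Fin n) (Fin n) ℂ → (Fin n → ℂ) → ℂ}
  {a : Matrix (Fin n ⊕ Unit) (Fin n ⊕ Unit) ℚ → ℂ}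

lemma divVec_emod {N : ℕ} (hN : 0 < N) (l : Fin n → ℤ) :
    divVec N l = divVec N (fun i => l i % N) + fun i => ((l i / N : ℤ) : ℝ) := by
  have hN' : (N : ℝ) ≠ 0 := by exact_mod_cast hN.ne'
  funext i
  have h : (l i : ℝ) = (l i % N : ℤ) + N * (l i / N : ℤ) := by
    exact_mod_cast (Int.emod_add_mul_ediv (l i) N).symm
  simp only [divVec, Pi.add_apply]
  rw [h]
  field_simp

lemma intR_transpose_mulVec_divVec (A : Matrix (Fin n) (Fin n) ℤ) (N : ℕ) (l : Fin n → ℤ) :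
    (intR A)ᵀ *ᵥ divVec N l = divVec N (Aᵀ *ᵥ l) := by
  ext i
  simp only [mulVec, dotProduct, divVec, transpose_apply, map_apply]
  push_cast
  rw [Finset.sum_div]
  exact Finset.sum_congr rfl fun j _ => by ring

lemma divVec_add (N : ℕ) (l μ : Fin n → ℤ) : divVec N l + divVec N μ = divVec N (l + μ) := by
  ext i
  simp only [divVec, Pi.add_apply]
  push_cast
  ring

/-- Every value of the invariant norm at an `N`-torsion point is attained at a torsion point over
the reduced region, with coordinates in a finite set. -/
lemma exists_jacNorm_eq_reduced {c : ℝ}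
    (hc : ∀ τ ∈ siegelUpperHalf (Fin n), ∃ γ ∈ symplecticGroup (Fin n) ℤ,
      (imMat (smulSiegel γ τ) - c • 1).PosSemidef) {N : ℕ} (hN : 0 < N)
    {τ : Matrix (Fin n) (Fin n) ℂ} (hτ : τ ∈ siegelUpperHalf (Fin n)) (l μ : Fin n → ℤ) :
    ∃ τ' ∈ siegelUpperHalf (Fin n), (imMat τ' - c • 1).PosSemidef ∧
      ∃ l' μ' : Fin n → Fin N, ∀ (m : ℕ) (ψ : Matrix (Fin n) (Fin n) ℂ → (Fin n → ℂ) → ℂ),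
        IsJacobiForm n κ m ψ → jacNorm κ m ψ τ (divVec N l) (divVec N μ) =
          jacNorm κ m ψ τ' (divVec N fun i => (l' i : ℤ)) (divVec N fun i => (μ' i : ℤ)) := by
  obtain ⟨γ, hγ, hY⟩ := hc τ hτ
  refine ⟨_, smulSiegel_mem hγ hτ, hY, ?_⟩
  have hdet : IsUnit γᵀ.det := by
    rw [det_transpose]; exact SymplecticGroup.symplectic_det hγ
  set v : Fin n ⊕ Fin n → ℤ := γᵀ⁻¹ *ᵥ Sum.elim l μ with hv
  have hv' : γᵀ *ᵥ v = Sum.elim l μ := by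
    rw [hv, mulVec_mulVec, mul_nonsing_inv _ hdet, one_mulVec]
  set x : Fin n → ℤ := fun i => v (.inl i) with hx
  set y : Fin n → ℤ := fun i => v (.inr i) with hy
  have hl : γ.toBlocks₁₁ᵀ *ᵥ x + γ.toBlocks₂₁ᵀ *ᵥ y = l := by
    ext i
    have := congrFun hv' (.inl i)
    simpa [mulVec, dotProduct, toBlocks₁₁, toBlocks₂₁] using this
  have hμ : γ.toBlocks₁₂ᵀ *ᵥ x + γ.toBlocks₂₂ᵀ *ᵥ y = μ := by
    ext i
    have := congrFun hv' (.inr i)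
    simpa [mulVec, dotProduct, toBlocks₁₂, toBlocks₂₂] using this
  have hN' : (0 : ℤ) < N := by exact_mod_cast hN
  have hmod (k : ℤ) : ∃ r : Fin N, ((r : ℕ) : ℤ) = k % N := by
    have h1 := Int.emod_nonneg k hN'.ne'
    have h2 := Int.emod_lt_of_pos k hN'
    exact ⟨⟨(k % N).toNat, by omega⟩, by simp [h1]⟩
  choose r hr using hmod
  refine ⟨fun i => r (x i), fun i => r (y i), fun m ψ hψ => ?_⟩
  simp only [hr]
  rw [← jacNorm_add_int hψ (smulSiegel_mem hγ hτ) (divVec N fun i => x i % N)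
    (divVec N fun i => y i % N) (fun i => x i / N) (fun i => y i / N), ← divVec_emod hN,
    ← divVec_emod hN, jacNorm_smulSiegel hψ hγ hτ]
  simp only [intR_transpose_mulVec_divVec, divVec_add, hl, hμ]

/-- The invariant norms of the coefficients of a cuspidal symmetric formal Fourier-Jacobi series
at torsion points grow subexponentially, uniformly in the point. -/
theorem exists_jacNorm_le_exp (hn : 1 ≤ n) (hf : ∀ m, IsJacobiForm n κ m (φ m))
    (ha : IsCoeffFamily φ a) (hsym : IsNormSymmetric a) (hcusp : IsCuspidal φ) {N : ℕ}
    (hN : 0 < N) {ε : ℝ} (hε : 0 < ε) :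
    ∃ C : ℝ, ∀ (m : ℕ), ∀ τ ∈ siegelUpperHalf (Fin n), ∀ l μ : Fin n → ℤ,
      jacNorm κ m (φ m) τ (divVec N l) (divVec N μ) ≤ C * Real.exp (ε * m) := by
  obtain ⟨c', hc', hred⟩ := exists_smulSiegel_imMat_ge hn
  obtain ⟨c, hc, rfl⟩ : ∃ c : ℝ, 0 < c ∧ 2 * c = c' := ⟨c' / 2, by positivity, by ring⟩
  obtain ⟨K, B, hK, hhalf⟩ := exists_jacNorm_le_half ha hsym hcusp κ hN hc
  choose C hC using fun l : Fin n → ℤ => exists_sum_small_coeff_le hn ha hsym hcusp hN l B hε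
  obtain ⟨C', hC'⟩ := Finite.exists_le fun l : Fin n → Fin N => C fun i => (l i : ℤ)
  refine ⟨2 * (K * C'), fun m τ hτ l μ => ?_⟩
  set V : Set ℝ := {x | ∃ τ ∈ siegelUpperHalf (Fin n), ∃ l μ : Fin n → ℤ,
    x = jacNorm κ m (φ m) τ (divVec N l) (divVec N μ)} with hV
  have hbdd : BddAbove V := by
    choose M hM using exists_jacNorm_le ha hsym hcusp κ hN hc m
    obtain ⟨M', hM'⟩ := Finite.exists_le fun l : Fin n → Fin N => M fun i => (l i : ℤ)
    refine ⟨M', ?_⟩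
    rintro _ ⟨τ, hτ, l, μ, rfl⟩
    obtain ⟨τ', hτ', hY, l', μ', h⟩ := exists_jacNorm_eq_reduced (κ := κ) hred hN hτ l μ
    rw [h m _ (hf m)]
    exact (hM _ τ' hτ' hY _).trans (hM' l')
  have hle {τ} (hτ : τ ∈ siegelUpperHalf (Fin n)) (l μ : Fin n → ℤ) :
      jacNorm κ m (φ m) τ (divVec N l) (divVec N μ) ≤ sSup V :=
    le_csSup hbdd ⟨τ, hτ, l, μ, rfl⟩
  have hsup : sSup V ≤ sSup V / 2 + K * (C' * Real.exp (ε * m)) := by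
    refine csSup_le ⟨_, τ, hτ, l, μ, rfl⟩ ?_
    rintro _ ⟨τ, hτ, l, μ, rfl⟩
    obtain ⟨τ', hτ', hY, l', μ', h⟩ := exists_jacNorm_eq_reduced (κ := κ) hred hN hτ l μ
    rw [h m _ (hf m)]
    refine hhalf m _ _ _ _ (fun τ hτ => hle hτ _ _) (fun F hF => ?_) τ' hτ' hY
    exact (hC _ m F hF).trans (mul_le_mul_of_nonneg_right (hC' l') (Real.exp_pos _).le)
  refine (hle hτ l μ).trans ?_
  linarith

end Reduction

end FJ

namespace FJ

open Matrix

section Convergence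

variable {n : ℕ}

lemma torsionC_latticePoint {τ : Matrix (Fin n) (Fin n) ℂ} (hτ : τ ∈ siegelUpperHalf (Fin n))
    (x y : Fin n → ℝ) : torsionC τ (latticePoint τ x y) = x ⬝ᵥ (imMat τ *ᵥ x) := by
  have him : (fun i => (latticePoint τ x y i).im) = imMat τ *ᵥ x := by
    ext i
    simp [latticePoint, realC, mulVec, dotProduct, imMat, Complex.im_sum]
  rw [torsionC, him, mulVec_mulVec, nonsing_inv_mul _ hτ.2.det_pos.ne'.isUnit, one_mulVec,
    dotProduct_comm]

/-- The coefficients of a cuspidal symmetric formal Fourier-Jacobi series at a torsion point. -/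
lemma exists_norm_le_of_isTorsionPoint {κ : ℤ}
    {φ : ℕ → Matrix (Fin n) (Fin n) ℂ → (Fin n → ℂ) → ℂ} (hn : 1 ≤ n)
    (hf : IsSymmetricFJ n κ φ) (hcusp : IsCuspidal φ) {N : ℕ} (hN : 0 < N)
    {τ : Matrix (Fin n) (Fin n) ℂ} {z : Fin n → ℂ} (hz : IsTorsionPoint N τ z) {ε : ℝ}
    (hε : 0 < ε) :
    ∃ C : ℝ, ∀ m : ℕ, ‖φ m τ z‖ ≤ C * Real.exp (2 * Real.pi * torsionC τ z + ε) ^ m := by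
  obtain ⟨a, ha, hsym⟩ := hf.exists_coeff
  obtain ⟨C, hC⟩ := exists_jacNorm_le_exp hn hf.jacobi ha hsym hcusp hN hε
  obtain ⟨hτ, l, μ, hlμ⟩ := hz
  have hz' : z = latticePoint τ (divVec N l) (divVec N μ) := by
    rw [hlμ, latticePoint]
    congr 2 <;> (ext i; simp [realC, divVec])
  have hD : 0 < (imMat τ).det ^ ((κ : ℝ) / 4) := Real.rpow_pos_of_pos hτ.2.det_pos _
  refine ⟨C / (imMat τ).det ^ ((κ : ℝ) / 4), fun m => ?_⟩
  have h := hC m τ hτ l μ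
  rw [jacNorm, ← hz', ← torsionC_latticePoint hτ (divVec N l) (divVec N μ), ← hz',
    Real.exp_neg] at h
  rw [← Real.exp_nat_mul, mul_add, Real.exp_add, div_mul_eq_mul_div, le_div_iff₀ hD]
  have h1 : 0 < Real.exp (2 * Real.pi * (m * torsionC τ z)) := Real.exp_pos _
  rw [mul_right_comm, ← div_eq_mul_inv, div_le_iff₀ h1] at h
  calc _ ≤ _ := h
    _ = _ := by rw [show (m : ℝ) * (2 * Real.pi * torsionC τ z) =
      2 * Real.pi * (m * torsionC τ z) by ring, mul_comm (m : ℝ) ε]; ring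

lemma summable_norm_mul_pow_of_growth {b : ℕ → ℂ} {A : ℝ}
    (hb : ∀ ε : ℝ, 0 < ε → ∃ C : ℝ, ∀ m : ℕ, ‖b m‖ ≤ C * Real.exp (A + ε) ^ m) {r : ℝ}
    (hr0 : 0 ≤ r) (hr : r < Real.exp (-A)) : Summable fun m : ℕ => ‖b m‖ * r ^ m := by
  obtain ⟨ρ, hrρ, hρ⟩ := exists_between hr
  have hρ0 : 0 < ρ := hr0.trans_lt hrρ
  have hε : 0 < -A - Real.log ρ := by
    have := (Real.log_lt_iff_lt_exp hρ0).mpr hρ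
    linarith
  obtain ⟨C, hC⟩ := hb _ hε
  have h1 : Real.exp (A + (-A - Real.log ρ)) = ρ⁻¹ := by
    rw [show A + (-A - Real.log ρ) = -Real.log ρ by ring, Real.exp_neg, Real.exp_log hρ0]
  simp only [h1] at hC
  have h2 : r / ρ < 1 := (div_lt_one hρ0).mpr hrρ
  refine Summable.of_nonneg_of_le (fun m => by positivity) (fun m => ?_)
    ((summable_geometric_of_lt_one (by positivity) h2).mul_left C)
  calc ‖b m‖ * r ^ m ≤ C * ρ⁻¹ ^ m * r ^ m := by gcongr; exact hC m
    _ = C * (r / ρ) ^ m := by rw [mul_assoc, ← mul_pow, div_eq_inv_mul]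

lemma differentiableOn_tsum_mul_pow {b : ℕ → ℂ} {R : ℝ}
    (hb : ∀ r : ℝ, 0 ≤ r → r < R → Summable fun m : ℕ => ‖b m‖ * r ^ m) :
    DifferentiableOn ℂ (fun q : ℂ => ∑' m : ℕ, b m * q ^ m) {q : ℂ | ‖q‖ < R} := by
  intro q hq
  obtain ⟨r, hqr, hr⟩ := exists_between (show ‖q‖ < R from hq)
  have hopen : IsOpen {q : ℂ | ‖q‖ < r} := isOpen_lt continuous_norm continuous_const
  refine DifferentiableAt.differentiableWithinAt ?_
  refine (Complex.differentiableOn_tsum_of_summable_norm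
    (hb r ((norm_nonneg q).trans hqr.le) hr) (fun m => by fun_prop) hopen
    (fun m w hw => ?_)).differentiableAt (hopen.mem_nhds hqr)
  rw [norm_mul, norm_pow]
  have : ‖w‖ ≤ r := le_of_lt hw
  gcongr

lemma torsionC_lt_im {τ : Matrix (Fin n ⊕ Unit) (Fin n ⊕ Unit) ℂ}
    (hτ : τ ∈ siegelUpperHalf (Fin n ⊕ Unit)) :
    torsionC τ.toBlocks₁₁ (fun i => τ (Sum.inl i) (Sum.inr ())) <
      (τ (Sum.inr ()) (Sum.inr ())).im := by
  set v : Fin n → ℝ := fun i => (τ (Sum.inl i) (Sum.inr ())).im with hv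
  set Y : Matrix (Fin n) (Fin n) ℝ := imMat τ.toBlocks₁₁ with hY
  have hYp : Y.PosDef := hτ.2.submatrix Sum.inl_injective
  set w : Fin n → ℝ := Y⁻¹ *ᵥ v with hw
  have hYw : Y *ᵥ w = v := by
    rw [hw, mulVec_mulVec, mul_nonsing_inv _ hYp.det_pos.ne'.isUnit, one_mulVec]
  have hne : Sum.elim (-w) (fun _ : Unit => (1 : ℝ)) ≠ 0 := fun h => by
    simpa using congrFun h (.inr ())
  have hpos := hτ.2.dotProduct_mulVec_pos hne
  have hmul : imMat τ *ᵥ Sum.elim (-w) (fun _ : Unit => (1 : ℝ)) =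
      Sum.elim (-(Y *ᵥ w) + v) fun _ => -(v ⬝ᵥ w) + (τ (Sum.inr ()) (Sum.inr ())).im := by
    ext (i | i)
    · simp [mulVec, dotProduct, imMat, hY, hv, toBlocks₁₁]
    · have hs (j : Fin n) : τ (.inr ()) (.inl j) = τ (.inl j) (.inr ()) := hτ.1.apply _ _
      simp [mulVec, dotProduct, imMat, hv, hs]
  rw [hmul, hYw] at hpos
  simp only [neg_add_cancel, star_trivial, dotProduct, Fintype.sum_sum_type, Sum.elim_inl,
    Sum.elim_inr] at hpos
  have h2 : torsionC τ.toBlocks₁₁ (fun i => τ (Sum.inl i) (Sum.inr ())) = v ⬝ᵥ w := rfl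
  rw [h2]
  simpa [dotProduct] using hpos

end Convergence

end FJ

theorem mainTheorem3 (n : ℕ) (hn : 1 ≤ n) (κ : ℤ)
    (φ : ℕ → Matrix (Fin n) (Fin n) ℂ → (Fin n → ℂ) → ℂ)
    (hf : FJ.IsSymmetricFJ n κ φ) (hcusp : FJ.IsCuspidal φ) :
    (∀ (N : ℕ), 0 < N → ∀ (τ₁ : Matrix (Fin n) (Fin n) ℂ) (z : Fin n → ℂ),
      FJ.IsTorsionPoint N τ₁ z →
        (∀ q : ℂ, ‖q‖ < Real.exp (-(2 * Real.pi * FJ.torsionC τ₁ z)) →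
          Summable (fun m : ℕ => ‖φ m τ₁ z * q ^ m‖)) ∧
        DifferentiableOn ℂ (fun q : ℂ => ∑' m : ℕ, φ m τ₁ z * q ^ m)
          {q : ℂ | ‖q‖ < Real.exp (-(2 * Real.pi * FJ.torsionC τ₁ z))}) ∧
    (∀ τ ∈ FJ.siegelUpperHalf (Fin n ⊕ Unit),
      (∃ N : ℕ, 0 < N ∧
        FJ.IsTorsionPoint N τ.toBlocks₁₁ (fun i => τ (Sum.inl i) (Sum.inr ()))) →
      Summable (fun m : ℕ =>
        ‖φ m τ.toBlocks₁₁ (fun i => τ (Sum.inl i) (Sum.inr ())) *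
          FJ.e (τ (Sum.inr ()) (Sum.inr ())) ^ m‖)) := by
  have hsum {N : ℕ} (hN : 0 < N) {τ₁ : Matrix (Fin n) (Fin n) ℂ} {z : Fin n → ℂ}
      (hz : FJ.IsTorsionPoint N τ₁ z) (r : ℝ) (hr0 : 0 ≤ r)
      (hr : r < Real.exp (-(2 * Real.pi * FJ.torsionC τ₁ z))) :
      Summable fun m : ℕ => ‖φ m τ₁ z‖ * r ^ m :=
    FJ.summable_norm_mul_pow_of_growth
      (fun _ hε => FJ.exists_norm_le_of_isTorsionPoint hn hf hcusp hN hz hε) hr0 hr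
  refine ⟨fun N hN τ₁ z hz => ⟨fun q hq => ?_, ?_⟩, ?_⟩
  · simpa only [norm_mul, norm_pow] using hsum hN hz ‖q‖ (norm_nonneg q) hq
  · exact FJ.differentiableOn_tsum_mul_pow (hsum hN hz)
  · rintro τ hτ ⟨N, hN, hz⟩
    simp only [norm_mul, norm_pow]
    refine hsum hN hz _ (norm_nonneg _) ?_
    rw [FJ.norm_e, Real.exp_lt_exp, neg_lt_neg_iff]
    exact mul_lt_mul_of_pos_left (FJ.torsionC_lt_im hτ) (by positivity)
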